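/- Let $M$ be a smooth finite-dimensional manifold, $\pi\colon S^2_{\mathrm{Lor}}T^*M\to M$ the bundle of symmetric bilinear forms of Lorentzian signature, and $J^k\pi$ the space of $k$-jets $[g]^k_a$ of local Lorentzian metrics $g$ on $M$, so that $J^0\pi=S^2_{\mathrm{Lor}}T^*M$. A vector field $X$ on $M$ prolongs to a vector field $X^{(k)}$ on $J^k\pi$, namely the generator of $[g]^k_a\mapsto[(\varphi_t^{-1})^*g]^k_{\varphi_t(a)}$, where $\varphi_t$ is the local flow of $X$. Let $h$ be the horizontal symmetric $2$-form on $J^0\pi$ given by $h_\theta(V,W)=\theta(d\pi V,d\pi W)$; it induces the bilinear form $h(V_1\wedge\dots\wedge V_r,W_1\wedge\dots\wedge W_r)=\det\big(h(V_i,W_j)\big)$ on $r$-vectors, and we write $\|P\|_h^2=h(P,P)$. For a function $f$ on $J^k\pi$ let $\bar d f$ be its horizontal differential, $(\bar d f)([g]^{k+1}_a)=d(f\circ j^kg)_a\in T_a^*M$, and let $\|\alpha\|_h^2=h^{-1}(\alpha,\alpha)$ for covectors $\alpha$ on $M$. Let $\mathcal E$ be a PDE on Lorentzian metrics, that is, a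 sequence of submanifolds $\mathcal E^k\subset J^k\pi$, $k\ge 0$, with $\mathcal E^{k+1}$ projecting into $\mathcal E^k$, and let $\mathfrak g$ be a (possibly infinite-dimensional) real Lie algebra of smooth vector fields on $M$ consisting of symmetries of $\mathcal E$: $X^{(k)}_\theta\in T_\theta\mathcal E^k$ for all $X\in\mathfrak g$, $k\ge0$ and $\theta\in\mathcal E^k$. For $\mu\in\mathfrak g^*$, a smooth function $f$ on $\mathcal E^k$ is called a relative differential invariant of order $k$ and weight $\mu$ if $X^{(k)}(f)=\mu_X f$ on $\mathcal E^k$ for all $X\in\mathfrak g$. Let $\mathfrak i=\langle K_1,\dots,K_r\rangle$ be an ideal of $\mathfrak g$ with $\dim\mathfrak i=r\ge1$. Then there is $\lambda\in\mathfrak g^*$ with $$L_X(K_1\wedge\dots\wedge K_r)=\lambda_X\,(K_1\wedge\dots\wedge K_r)\qquad\text{for all }X\in\mathfrak g.$$ Consequently, for every such $\lambda$, the function $$R^{\mathfrak i}=\|K_1^{(0)}\wedge\dots\wedge K_r^{(0)}\|_h^2$$ on $\mathcal E^0\subset J^0\pi$ is a relative differential invariant of order $0$ and weight $2\lambda$,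 and the function $$S^{\mathfrak i}=\|\bar dR^{\mathfrak i}\|_h^2$$ on $\mathcal E^1\subset J^1\pi$ is a relative differential invariant of order $1$ and weight $4\lambda$. -/

import Mathlib

open Set Filter Topology
open scoped Manifold ContDiff

set_option maxSynthPendingDepth 3
set_option synthInstance.maxHeartbeats 200000

noncomputable section

namespace JetInv

/-! ### Linear algebra -/

section Linear

variable {V : Type*} [AddCommGroup V] [Module ℝ V] [TopologicalSpace V]
  [IsTopologicalAddGroup V] [ContinuousSMul ℝ V]

/-- Symmetric bilinear forms of Lorentzian signature `(-,+,…,+)`: some basis brings the form to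
`diag(-1, 1, …, 1)`. -/
def IsLorentzian (b : V →L[ℝ] V →L[ℝ] ℝ) : Prop :=
  ∃ (m : ℕ) (e : Module.Basis (Fin (m + 1)) ℝ V), ∀ i j,
    b (e i) (e j) = if i = j then (if i = 0 then -1 else 1) else 0

/-- The linear map `v ↦ b(v, ·)` from `V` to its dual. -/
def flat (b : V →L[ℝ] V →L[ℝ] ℝ) : V →ₗ[ℝ] Module.Dual ℝ V :=
  (ContinuousLinearMap.coeLM ℝ).comp (b : V →ₗ[ℝ] (V →L[ℝ] ℝ))

/-- The square norm `b(p, p)` of an `r`-vector `p ∈ Λ^r V`, for the bilinear form on `Λ^r V`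
induced by `b`, namely `b(v₁ ∧ … ∧ v_r, w₁ ∧ … ∧ w_r) = det (b(v_i, w_j))`. -/
def mvNormSq (b : V →L[ℝ] V →L[ℝ] ℝ) {r : ℕ} (p : ⋀[ℝ]^r V) : ℝ :=
  exteriorPower.pairingDual ℝ V r (exteriorPower.map r (flat b) p) p

/-- The square norm `b⁻¹(α, α)` of a covector `α` for a nondegenerate form `b`:
it is `α(v)`, where `v` is the vector with `b(v, ·) = α`. -/
def covNormSq (b : V →L[ℝ] V →L[ℝ] ℝ) (α : V →L[ℝ] ℝ) : ℝ :=
  α (ContinuousLinearMap.inverse b α)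

end Linear

/-! ### Vector fields, charts, multivector fields -/

variable (E : Type*) [NormedAddCommGroup E] [NormedSpace ℝ E]
variable (M : Type*) [TopologicalSpace M] [ChartedSpace E M]

/-- (Not necessarily smooth) vector fields on `M`. -/
abbrev VField : Type _ := Π x : M, TangentSpace 𝓘(ℝ, E) x

/-- A real Lie algebra of smooth vector fields on `M`. -/
structure VFLieAlgebra [IsManifold 𝓘(ℝ, E) ∞ M] extends Submodule ℝ (VField E M) where
  smooth : ∀ X ∈ carrier, ContMDiff 𝓘(ℝ, E) 𝓘(ℝ, E).tangent ∞
    (fun x ↦ (⟨x, X x⟩ : TangentBundle 𝓘(ℝ, E) M))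
  bracket_mem : ∀ X ∈ carrier, ∀ Y ∈ carrier, VectorField.mlieBracket 𝓘(ℝ, E) X Y ∈ carrier

/-- The smooth charts of `M`. -/
abbrev charts : Set (OpenPartialHomeomorph M E) := IsManifold.maximalAtlas 𝓘(ℝ, E) ∞ M

variable {E M}

/-- `𝔦` is an ideal of the Lie algebra `𝔤` of vector fields. -/
def IsIdeal [IsManifold 𝓘(ℝ, E) ∞ M] (𝔤 : VFLieAlgebra E M) (𝔦 : Submodule ℝ (VField E M)) : Prop :=
  𝔦 ≤ 𝔤.toSubmodule ∧
    ∀ X ∈ 𝔤.toSubmodule, ∀ K ∈ 𝔦, VectorField.mlieBracket 𝓘(ℝ, E) X K ∈ 𝔦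

/-- The derivative at `y` of the inverse of a chart. -/
abbrev dsymm (φ : OpenPartialHomeomorph M E) (y : E) :
    E →L[ℝ] TangentSpace 𝓘(ℝ, E) (φ.symm y) :=
  mfderiv 𝓘(ℝ, E) 𝓘(ℝ, E) φ.symm y

/-- The coordinate expression of a vector field in a chart. -/
def vfRep (φ : OpenPartialHomeomorph M E) (X : VField E M) : E → E :=
  VectorField.mpullback 𝓘(ℝ, E) 𝓘(ℝ, E) φ.symm X

/-- Multivector fields of degree `r` (sections of `Λ^r TM`). -/
abbrev MVField (E : Type*) [NormedAddCommGroup E] [NormedSpace ℝ E]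
    (M : Type*) [TopologicalSpace M] [ChartedSpace E M] (r : ℕ) : Type _ :=
  Π x : M, ⋀[ℝ]^r (TangentSpace 𝓘(ℝ, E) x)

/-- The multivector field `K₁ ∧ … ∧ K_r`. -/
def wedge {r : ℕ} (K : Fin r → VField E M) : MVField E M r :=
  fun x ↦ exteriorPower.ιMulti ℝ r (fun i ↦ K i x)

/-- The component `P(α₁, …, α_r) = ⟨α₁ ∧ … ∧ α_r, P⟩`, at the point with coordinates `y`, of the
coordinate expression of a multivector field `P` in a chart. -/
def mvComp {r : ℕ} (φ : OpenPartialHomeomorph M E) (P : MVField E M r)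
    (α : Fin r → Module.Dual ℝ E) (y : E) : ℝ :=
  exteriorPower.pairingDual ℝ E r (exteriorPower.ιMulti ℝ r α)
    (exteriorPower.map r ((dsymm φ y).inverse : TangentSpace 𝓘(ℝ, E) (φ.symm y) →ₗ[ℝ] E)
      (P (φ.symm y)))

/-- `L_X P = Q` for multivector fields, in components in every chart:
`(L_X P)(α₁,…,α_r) = X(P(α₁,…,α_r)) - ∑ᵢ P(α₁,…,αᵢ ∘ DX,…,α_r)` for constant covectors `αᵢ`, that is
`(L_X P)^{j₁…j_r} = X^l ∂_l P^{j₁…j_r} - ∑ᵢ P^{j₁…l…j_r} ∂_l X^{jᵢ}`. -/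
def IsLieDerivative {r : ℕ} (X : VField E M) (P Q : MVField E M r) : Prop :=
  ∀ φ ∈ charts E M, ∀ y ∈ φ.target, ∀ α : Fin r → Module.Dual ℝ E,
    DifferentiableAt ℝ (mvComp φ P α) y ∧
    mvComp φ Q α y = fderiv ℝ (mvComp φ P α) y (vfRep φ X y)
      - ∑ i, mvComp φ P
          (Function.update α i (α i ∘ₗ (fderiv ℝ (vfRep φ X) y : E →ₗ[ℝ] E))) y

/-! ### Local metrics and their jets -/

/-- The coordinate expression in a chart of a field of bilinear forms on `M`. -/
def formRep (φ : OpenPartialHomeomorph M E)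
    (g : Π x : M, TangentSpace 𝓘(ℝ, E) x →L[ℝ] TangentSpace 𝓘(ℝ, E) x →L[ℝ] ℝ) :
    E → E →L[ℝ] E →L[ℝ] ℝ :=
  fun y ↦ ContinuousLinearMap.bilinearComp (E := E) (F := E) (g (φ.symm y)) (dsymm φ y) (dsymm φ y)

variable (E M)

/-- A smooth Lorentzian metric on an open subset `dom` of `M`
(the values of `toFun` outside `dom` are irrelevant). -/
structure LocalMetric where
  dom : Set M
  isOpen_dom : IsOpen dom
  toFun : Π x : M, TangentSpace 𝓘(ℝ, E) x →L[ℝ] TangentSpace 𝓘(ℝ, E) x →L[ℝ] ℝ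
  lorentzian : ∀ x ∈ dom, IsLorentzian (toFun x)
  smooth : ∀ φ ∈ charts E M, ContDiffOn ℝ ∞ (formRep φ toFun) (φ.target ∩ φ.symm ⁻¹' dom)

/-- Two metrics near `a` are `k`-equivalent at `a` if their components in the charts around `a`
have the same Taylor polynomials of degree `k` at `a`. -/
def jetSetoid (k : ℕ) (a : M) : Setoid {g : LocalMetric E M // a ∈ g.dom} where
  r g g' := ∀ φ ∈ charts E M, a ∈ φ.source → ∀ i ≤ k,
    iteratedFDeriv ℝ i (formRep φ g.1.toFun) (φ a) = iteratedFDeriv ℝ i (formRep φ g'.1.toFun) (φ a)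
  iseqv :=
    { refl := fun _ _ _ _ _ _ ↦ rfl
      symm := fun h φ hφ ha i hi ↦ (h φ hφ ha i hi).symm
      trans := fun h h' φ hφ ha i hi ↦ (h φ hφ ha i hi).trans (h' φ hφ ha i hi) }

/-- The space of `k`-jets at `a` of Lorentzian metrics. -/
def JetAt (k : ℕ) (a : M) : Type _ := Quotient (jetSetoid E M k a)

/-- The jet space `J^k π` of the bundle `π : S²_Lor T*M → M`; in particular `J⁰π = S²_Lor T*M`. -/
structure Jet (k : ℕ) where
  pt : M
  jet : JetAt E M k pt

/-- The coordinate space of `J^k π`: base coordinates `x` and derivatives `(u_{ij})_σ` of order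
`|σ| ≤ k`, collected by order. -/
abbrev JetCoord (E : Type*) [NormedAddCommGroup E] [NormedSpace ℝ E] (k : ℕ) : Type _ :=
  E × (Π i : Fin (k + 1), ContinuousMultilinearMap ℝ (fun _ : Fin i ↦ E) (E →L[ℝ] E →L[ℝ] ℝ))

variable {E M}

/-- The `k`-jet `[g]^k_x` of a local metric `g` at a point `x` of its domain. -/
def LocalMetric.jet (g : LocalMetric E M) (k : ℕ) (x : M) (hx : x ∈ g.dom) : Jet E M k :=
  ⟨x, Quotient.mk (jetSetoid E M k x) ⟨g, hx⟩⟩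

/-- A metric that represents a given jet. -/
def Jet.rep {k : ℕ} (θ : Jet E M k) : LocalMetric E M := (Quotient.out θ.jet).1

/-- The projection `π_{k+1,k}`. -/
def Jet.proj {k : ℕ} (θ : Jet E M (k + 1)) : Jet E M k :=
  ⟨θ.pt, Quotient.map (sa := jetSetoid E M (k + 1) θ.pt) (sb := jetSetoid E M k θ.pt) id
    (fun _ _ h φ hφ ha i hi ↦ h φ hφ ha i (hi.trans (Nat.le_succ k))) θ.jet⟩

/-- The canonical coordinates `(x, (u_{ij})_σ)` on `J^k π` induced by a chart `φ` of `M`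
(meaningful at jets whose base point lies in the domain of `φ`). -/
def Jet.coord {k : ℕ} (φ : OpenPartialHomeomorph M E) (θ : Jet E M k) : JetCoord E k :=
  (φ θ.pt, fun i ↦ iteratedFDeriv ℝ i (formRep φ θ.rep.toFun) (φ θ.pt))

/-- The Lorentzian form `h_θ` on `T_a M` determined by a jet `θ` at `a`. -/
def Jet.form {k : ℕ} (θ : Jet E M k) :
    TangentSpace 𝓘(ℝ, E) θ.pt →L[ℝ] TangentSpace 𝓘(ℝ, E) θ.pt →L[ℝ] ℝ :=
  θ.rep.toFun θ.pt

/-! ### Prolongation of vector fields -/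

/-- The Lie derivative `L_X g` of a field of bilinear forms, in coordinates. -/
def lieForm (X : E → E) (g : E → E →L[ℝ] E →L[ℝ] ℝ) : E → E →L[ℝ] E →L[ℝ] ℝ :=
  fun y ↦ fderiv ℝ g y (X y)
    + (g y).bilinearComp (fderiv ℝ X y) (ContinuousLinearMap.id ℝ E)
    + (g y).bilinearComp (ContinuousLinearMap.id ℝ E) (fderiv ℝ X y)

/-- The prolongation `X^{(k)}` at a jet `θ = [g]^k_a`, in the coordinates of a chart:
`X^{(k)} = X^l D_l + ∑_σ D_σ(-L_X h) ∂_{u_σ}`, that is, the coefficient of `∂_{u_σ}` at `θ` is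
`X^l ∂_l ∂_σ g - ∂_σ (L_X g)` at `a`. The derivatives of `g` of order `k + 1` cancel, so that this
depends on `θ` alone. For `k = 0` this is the lift determined by `L_{X^{(0)}} h = 0`. -/
def prolong {k : ℕ} (φ : OpenPartialHomeomorph M E) (X : VField E M) (θ : Jet E M k) :
    JetCoord E k :=
  (vfRep φ X (φ θ.pt), fun i ↦
    fderiv ℝ (iteratedFDeriv ℝ i (formRep φ θ.rep.toFun)) (φ θ.pt) (vfRep φ X (φ θ.pt))
      - iteratedFDeriv ℝ i (lieForm (vfRep φ X) (formRep φ θ.rep.toFun)) (φ θ.pt))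

/-- The curve `γ` in `J^k π` passes at time `0` through `θ` with velocity `X^{(k)}_θ`. -/
def HasProlongedVelocity {k : ℕ} (X : VField E M) (θ : Jet E M k) (γ : ℝ → Jet E M k) : Prop :=
  γ 0 = θ ∧ ContinuousAt (fun t ↦ (γ t).pt) 0 ∧
    ∀ φ ∈ charts E M, θ.pt ∈ φ.source →
      HasDerivAt (fun t ↦ (γ t).coord φ) (prolong φ X θ) 0

/-! ### Submanifolds, PDEs and their symmetries -/

/-- Embedded submanifolds of `J^k π`: in the canonical coordinates, a smooth local change of
coordinates straightens the set to a linear subspace. -/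
def IsSubmanifold {k : ℕ} (N : Set (Jet E M k)) : Prop :=
  ∀ θ ∈ N, ∀ φ ∈ charts E M, θ.pt ∈ φ.source →
    ∃ (Ψ : OpenPartialHomeomorph (JetCoord E k) (JetCoord E k))
      (L : Submodule ℝ (JetCoord E k)),
      θ.coord φ ∈ Ψ.source ∧ ContDiffOn ℝ ∞ Ψ Ψ.source ∧ ContDiffOn ℝ ∞ Ψ.symm Ψ.target ∧
      Ψ '' (Ψ.source ∩ Jet.coord φ '' {η ∈ N | η.pt ∈ φ.source}) = Ψ.target ∩ L

/-- Smooth functions on a subset `N` of `J^k π`: near each point they extend, in the canonical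
coordinates, to smooth functions. -/
def IsSmoothFun {k : ℕ} {N : Set (Jet E M k)} (f : N → ℝ) : Prop :=
  ∀ θ : N, ∀ φ ∈ charts E M, θ.1.pt ∈ φ.source →
    ∃ (W : Set (JetCoord E k)) (F : JetCoord E k → ℝ),
      IsOpen W ∧ θ.1.coord φ ∈ W ∧ ContDiffOn ℝ ∞ F W ∧
      ∀ η : N, η.1.pt ∈ φ.source → η.1.coord φ ∈ W → f η = F (η.1.coord φ)

/-- `X^{(k)}_θ` is tangent to `N` at `θ`: it is the velocity of a curve in `N`. -/
def IsTangentAt {k : ℕ} (N : Set (Jet E M k)) (X : VField E M) (θ : Jet E M k) : Prop :=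
  ∃ γ : ℝ → N, HasProlongedVelocity X θ (fun t ↦ (γ t).1)

/-- `(X^{(k)} f)(θ) = c` for a function `f` on `N`, where `X^{(k)}` is tangent to `N` at `θ`:
`f` has derivative `c` along every curve in `N` with velocity `X^{(k)}_θ`. -/
def HasDerivAlong {k : ℕ} {N : Set (Jet E M k)} (X : VField E M) (f : N → ℝ) (c : ℝ) (θ : N) :
    Prop :=
  IsTangentAt N X θ.1 ∧
    ∀ γ : ℝ → N, HasProlongedVelocity X θ.1 (fun t ↦ (γ t).1) →
      HasDerivAt (fun t ↦ f (γ t)) c 0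

variable (E M)

/-- A PDE on Lorentzian metrics: a tower of submanifolds `ℰ^k ⊂ J^k π`. -/
structure JetPDE where
  eqn : ∀ k : ℕ, Set (Jet E M k)
  isSubmanifold : ∀ k, IsSubmanifold (eqn k)
  proj_mem : ∀ k, ∀ θ ∈ eqn (k + 1), θ.proj ∈ eqn k

variable {E M}

/-- `𝔤` consists of (infinitesimal) symmetries of `ℰ`: `X^{(k)}` is tangent to `ℰ^k`. -/
def IsSymmetryAlgebra [IsManifold 𝓘(ℝ, E) ∞ M] (𝔤 : VFLieAlgebra E M) (ℰ : JetPDE E M) : Prop :=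
  ∀ X ∈ 𝔤.toSubmodule, ∀ k, ∀ θ ∈ ℰ.eqn k, IsTangentAt (ℰ.eqn k) X θ

/-- The smooth function `f` on `ℰ^k` is a relative differential invariant of order `k` with
(constant) weight `μ ∈ 𝔤*`: `X^{(k)} f = μ_X f` on `ℰ^k` for all `X ∈ 𝔤`. -/
def IsRelativeInvariant [IsManifold 𝓘(ℝ, E) ∞ M] (𝔤 : VFLieAlgebra E M) (ℰ : JetPDE E M) (k : ℕ) (f : ℰ.eqn k → ℝ)
    (μ : Module.Dual ℝ 𝔤.toSubmodule) : Prop :=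
  IsSmoothFun f ∧
    ∀ (X : 𝔤.toSubmodule) (θ : ℰ.eqn k), HasDerivAlong X.1 f (μ X * f θ) θ

/-! ### The horizontal form, the horizontal differential, and the two functions -/

/-- The differential of the projection `J^k π → M` at `θ`, applied to tangent vectors given in the
coordinates of a chart `φ` around the base point of `θ`. -/
def Jet.dproj {k : ℕ} (φ : OpenPartialHomeomorph M E) (θ : Jet E M k) :
    JetCoord E k →L[ℝ] TangentSpace 𝓘(ℝ, E) θ.pt :=
  ContinuousLinearMap.comp (R₁ := ℝ)
    ((mfderiv 𝓘(ℝ, E) 𝓘(ℝ, E) φ θ.pt).inverse : E →L[ℝ] TangentSpace 𝓘(ℝ, E) θ.pt)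
    (ContinuousLinearMap.fst ℝ E _)

/-- The horizontal symmetric 2-form `h` on `J⁰π = S²_Lor T*M`, `h_θ(V, W) = θ(dπ V, dπ W)`, on
tangent vectors given in the coordinates of a chart. -/
def horizontalForm (φ : OpenPartialHomeomorph M E) (θ : Jet E M 0) :
    JetCoord E 0 →L[ℝ] JetCoord E 0 →L[ℝ] ℝ :=
  ContinuousLinearMap.bilinearComp (E := E) (F := E) θ.form (θ.dproj φ) (θ.dproj φ)

/-- The function `R = ‖K₁^{(0)} ∧ … ∧ K_r^{(0)}‖_h²` on `J⁰π`. -/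
def RFun {r : ℕ} (K : Fin r → VField E M) (θ : Jet E M 0) : ℝ :=
  mvNormSq (horizontalForm (chartAt E θ.pt) θ)
    (exteriorPower.ιMulti ℝ r (fun i ↦ prolong (chartAt E θ.pt) (K i) θ))

open Classical in
/-- The function `f_g = f ∘ j^k g` on `M` (zero outside the domain of `g`). -/
def pullFun {k : ℕ} (f : Jet E M k → ℝ) (g : LocalMetric E M) (x : M) : ℝ :=
  if hx : x ∈ g.dom then f (g.jet k x hx) else 0

/-- The horizontal differential of a function `f` on `J^k π`: `(d̄f)([g]^{k+1}_a) = d(f ∘ j^k g)_a`,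
a covector at `a`. For smooth `f` this does not depend on the metric `g` representing the jet. -/
def hdiff {k : ℕ} (f : Jet E M k → ℝ) (θ : Jet E M (k + 1)) :
    TangentSpace 𝓘(ℝ, E) θ.pt →L[ℝ] ℝ :=
  mfderiv 𝓘(ℝ, E) 𝓘(ℝ, ℝ) (pullFun f θ.rep) θ.pt

/-- The function `S = ‖d̄R‖_h²` on `J¹π`. -/
def SFun {r : ℕ} (K : Fin r → VField E M) (θ : Jet E M 1) : ℝ :=
  covNormSq θ.form (hdiff (RFun K) θ)

end JetInv

end

set_option linter.unusedSectionVars false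
set_option linter.style.haveILetI false

noncomputable section

namespace JetInv

/-! ### The derivative of the determinant -/

section Det

open Matrix

variable {n : Type*} [Fintype n] [DecidableEq n]

/-! Everything is checked in a chart, where `Kᵢ` becomes a field `kᵢ` on `E` and `R` becomes the
Gram determinant `F(y, u) = det u(kᵢ y, kⱼ y)`.

Weight: if `[X, Kᵢ] = ∑ cᵢₗ Kₗ`, then with `A = (αⱼ(kᵢ))` the Lie derivative of the wedge, evaluated
on covectors `αⱼ`, is `tr(adj A · c · A) = tr c · det A`. So `λ_X` can be taken to be the trace of
`ad X` on `𝔦` (`exists_weight`).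

`R`: the prolonged field moves `u` by `-(u(DX·, ·) + u(·, DX·))`, so by Jacobi's formula the
derivative of `F` is `tr(adj G · (u([X, kᵢ], kⱼ) + u(kᵢ, [X, kⱼ])))`, where `G` is the Gram matrix.
The Lie derivative identity, with the covectors `u(·, kⱼ)` and then `u(kⱼ, ·)`, turns each half into
`λ F`, whence `2λ` (`fderiv_gram_lie`).

`S`: differentiating `X⁽⁰⁾F = 2λ F` along the graph of a representing metric, with symmetry of
second derivatives, shows that the horizontal differential transforms as a covector multiplied by
weight `2λ` (`fderiv_horDiff_prolong`). The metric itself has weight zero, so the square norm has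
weight `4λ` (`fderiv_covNormSq_horDiff`).

Both identities return to functions on the equation by the chain rule along curves
(`hasDerivAlong_of_coord`). -/

theorem sum_det_updateRow (A B : Matrix n n ℝ) :
    ∑ i, (A.updateRow i (B i)).det = (A.adjugate * B).trace := by
  simp only [← cramer_transpose_apply, cramer_eq_adjugate_mulVec, ← adjugate_transpose, trace,
    mulVec, dotProduct, transpose_apply, diag_apply, mul_apply]
  exact Finset.sum_comm

/-- Row sums arise from differentiating a determinant, column sums from replacing one covector at a
time in the Lie derivative. Writing both as the same trace lets them be subtracted. -/
theorem sum_det_updateCol (A B : Matrix n n ℝ) :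
    ∑ j, (A.updateCol j (fun i ↦ B i j)).det = (A.adjugate * B).trace := by
  simp only [← cramer_apply, cramer_eq_adjugate_mulVec, trace, mulVec, dotProduct, diag_apply,
    mul_apply]

theorem trace_adjugate_transpose_mul (A B : Matrix n n ℝ) :
    (Aᵀ.adjugate * Bᵀ).trace = (A.adjugate * B).trace := by
  rw [← adjugate_transpose, ← transpose_mul, trace_transpose, trace_mul_comm]

/-- The determinant as a continuous multilinear function of the rows. -/
def detRow (n : Type*) [Fintype n] [DecidableEq n] :
    ContinuousMultilinearMap ℝ (fun _ : n ↦ n → ℝ) ℝ where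
  toMultilinearMap := (detRowAlternating (n := n) (R := ℝ)).toMultilinearMap
  cont := Continuous.matrix_det (A := fun M : Matrix n n ℝ ↦ M) continuous_id

/-- Jacobi's formula: the determinant is multilinear in the rows, so its derivative replaces one row
at a time. -/
theorem hasFDerivAt_det {V : Type*} [NormedAddCommGroup V] [NormedSpace ℝ V]
    {A : V → Matrix n n ℝ} {A' : n → n → V →L[ℝ] ℝ} {x : V}
    (h : ∀ i j, HasFDerivAt (fun z ↦ A z i j) (A' i j) x) :
    ∃ D : V →L[ℝ] ℝ, HasFDerivAt (fun z ↦ (A z).det) D x ∧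
      ∀ v, D v = ((A x).adjugate * Matrix.of fun i j ↦ A' i j v).trace := by
  have h1 : HasFDerivAt (fun z ↦ (fun i j ↦ A z i j : n → n → ℝ))
      (ContinuousLinearMap.pi fun i ↦ ContinuousLinearMap.pi fun j ↦ A' i j) x :=
    hasFDerivAt_pi.2 fun i ↦ hasFDerivAt_pi.2 fun j ↦ h i j
  have h2 := HasFDerivAt.comp (g := fun M : n → n → ℝ ↦ detRow n M) x
    ((detRow n).hasFDerivAt (fun i j ↦ A x i j)) h1
  refine ⟨_, h2, fun v ↦ ?_⟩
  rw [← sum_det_updateRow, ContinuousLinearMap.comp_apply,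
    ContinuousMultilinearMap.linearDeriv_apply]
  rfl

theorem contDiffAt_det {V : Type*} [NormedAddCommGroup V] [NormedSpace ℝ V]
    {A : V → Matrix n n ℝ} {x : V} {m : ℕ∞ω} (h : ∀ i j, ContDiffAt ℝ m (fun z ↦ A z i j) x) :
    ContDiffAt ℝ m (fun z ↦ (A z).det) x :=
  (detRow n).contDiff.contDiffAt.comp x (contDiffAt_pi.2 fun i ↦ contDiffAt_pi.2 fun j ↦ h i j)

end Det

/-! ### Gram determinants -/

section Gram

open Matrix VectorField

variable {E : Type*} [NormedAddCommGroup E] [NormedSpace ℝ E] {r : ℕ}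

/-- The Gram determinant of the vectors `k i y` for the form `u`, as a function of `(y, u)`. -/
def gram (k : Fin r → E → E) (p : E × (E →L[ℝ] E →L[ℝ] ℝ)) : ℝ :=
  (Matrix.of fun i j ↦ p.2 (k i p.1) (k j p.1)).det

theorem contDiffAt_gram {k : Fin r → E → E} {p : E × (E →L[ℝ] E →L[ℝ] ℝ)} {m : ℕ∞ω}
    (hk : ∀ i, ContDiffAt ℝ m (k i) p.1) : ContDiffAt ℝ m (gram k) p := by
  refine contDiffAt_det fun i j ↦ ?_
  have h (i) : ContDiffAt ℝ m (fun q : E × (E →L[ℝ] E →L[ℝ] ℝ) ↦ k i q.1) p :=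
    (hk i).comp p contDiffAt_fst
  exact (contDiffAt_snd.clm_apply (h i)).clm_apply (h j)

theorem fderiv_gram {k : Fin r → E → E} {p : E × (E →L[ℝ] E →L[ℝ] ℝ)}
    (hk : ∀ i, DifferentiableAt ℝ (k i) p.1) (v : E × (E →L[ℝ] E →L[ℝ] ℝ)) :
    fderiv ℝ (gram k) p v = ((Matrix.of fun i j ↦ p.2 (k i p.1) (k j p.1)).adjugate *
      Matrix.of fun i j ↦ v.2 (k i p.1) (k j p.1) + p.2 (fderiv ℝ (k i) p.1 v.1) (k j p.1)
        + p.2 (k i p.1) (fderiv ℝ (k j) p.1 v.1)).trace := by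
  have h (i) : HasFDerivAt (fun q : E × (E →L[ℝ] E →L[ℝ] ℝ) ↦ k i q.1)
      ((fderiv ℝ (k i) p.1).comp (ContinuousLinearMap.fst ℝ _ _)) p :=
    (hk i).hasFDerivAt.comp p hasFDerivAt_fst
  obtain ⟨D, hD, hDv⟩ := hasFDerivAt_det
    (A := fun q : E × (E →L[ℝ] E →L[ℝ] ℝ) ↦ Matrix.of fun i j ↦ q.2 (k i q.1) (k j q.1))
    (fun i j ↦ (hasFDerivAt_snd.clm_apply (h i)).clm_apply (h j))
  have : fderiv ℝ (gram k) p = D := hD.fderiv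
  rw [this, hDv]
  congr 3
  ext i j
  simp
  ring

/-- If `∑ i, k₁ ∧ … ∧ c i ∧ … ∧ k_r = l • k₁ ∧ … ∧ k_r`, where `c i` is the Lie bracket of `X` and
`k i`, then the Gram determinant has weight `2 * l`. -/
theorem fderiv_gram_lie {k : Fin r → E → E} {X : E → E} {y : E} {l : ℝ}
    (hk : ∀ i, DifferentiableAt ℝ (k i) y)
    (hl : ∀ α : Fin r → Module.Dual ℝ E, l * (Matrix.of fun i j ↦ α j (k i y)).det =
      ((Matrix.of fun i j ↦ α j (k i y)).adjugate *
        Matrix.of fun i j ↦ α j (lieBracket ℝ X (k i) y)).trace)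
    (u : E →L[ℝ] E →L[ℝ] ℝ) :
    fderiv ℝ (gram k) (y, u) (X y,
      -(u.bilinearComp (fderiv ℝ X y) (ContinuousLinearMap.id ℝ E)
        + u.bilinearComp (ContinuousLinearMap.id ℝ E) (fderiv ℝ X y))) =
      2 * l * gram k (y, u) := by
  rw [fderiv_gram hk]
  -- The covectors are frozen at `y`. The first choice yields the terms `u([X, kᵢ], kⱼ)`; the second
  -- yields `u(kᵢ, [X, kⱼ])` after a transposition, so `u` need not be symmetric.
  have h1 := hl (fun j ↦ (u.flip (k j y) : E →ₗ[ℝ] ℝ))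
  have h2 := hl (fun j ↦ (u (k j y) : E →ₗ[ℝ] ℝ))
  rw [← trace_adjugate_transpose_mul, ← det_transpose] at h2
  simp only [ContinuousLinearMap.coe_coe, ContinuousLinearMap.flip_apply] at h1 h2
  set G : Matrix (Fin r) (Fin r) ℝ := Matrix.of fun i j ↦ u (k i y) (k j y) with hG
  have hG' : (Matrix.of fun i j ↦ u (k j y) (k i y))ᵀ = G := rfl
  rw [hG'] at h2
  have : gram k (y, u) = G.det := rfl
  rw [this, show 2 * l * G.det = l * G.det + l * G.det by ring]
  nth_rewrite 1 [h1]
  rw [h2, ← trace_add, ← mul_add]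
  congr 2
  ext i j
  -- In `[X, k] = Dk(X) - DX(k)`, the first term comes from moving the base point and the second
  -- from moving `u`.
  simp [lieBracket]
  ring

end Gram

/-! ### Horizontal differentials in coordinates -/

section Horizontal

variable {E B : Type*} [NormedAddCommGroup E] [NormedSpace ℝ E]
  [NormedAddCommGroup B] [NormedSpace ℝ B]

theorem two_le_infty : (2 : ℕ∞ω) ≤ ∞ := WithTop.coe_le_coe.2 (le_top (a := (2 : ℕ∞)))

/-- The horizontal differential of a function `F` of `(y, u)`, as a function of `(y, u, ∂u)`. -/
def horDiff (F : E × B → ℝ) (q : E × B × (E →L[ℝ] B)) : E →L[ℝ] ℝ :=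
  (fderiv ℝ F (q.1, q.2.1)).comp ((ContinuousLinearMap.id ℝ E).prod q.2.2)

theorem contDiffAt_horDiff {F : E × B → ℝ} {q : E × B × (E →L[ℝ] B)}
    (hF : ContDiffAt ℝ ∞ F (q.1, q.2.1)) : ContDiffAt ℝ ∞ (horDiff F) q := by
  have h1 : ContDiffAt ℝ ∞ (fun q : E × B × (E →L[ℝ] B) ↦ (q.1, q.2.1)) q := by fun_prop
  have h2 : ContDiffAt ℝ ∞ (fderiv ℝ F) (q.1, q.2.1) := hF.fderiv_right (by simp)
  refine ContDiffAt.clm_comp (h2.comp (f := fun q : E × B × (E →L[ℝ] B) ↦ (q.1, q.2.1)) q h1) ?_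
  have h3 (L : E →L[ℝ] B) : (ContinuousLinearMap.id ℝ E).prod L =
      ContinuousLinearMap.inl ℝ E B + (ContinuousLinearMap.inr ℝ E B).comp L := by
    ext <;> simp
  simp only [h3]
  fun_prop

theorem fderiv_comp_graph {F : E × B → ℝ} {g : E → B} {y : E}
    (hF : DifferentiableAt ℝ F (y, g y)) (hg : DifferentiableAt ℝ g y) :
    fderiv ℝ (fun z ↦ F (z, g z)) y = horDiff F (y, g y, fderiv ℝ g y) :=
  (hF.hasFDerivAt.comp y ((hasFDerivAt_id y).prodMk hg.hasFDerivAt)).fderiv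

/-- The infinitesimal transformation of the horizontal differential of a relative invariant. -/
theorem fderiv_horDiff_prolong {F : E × B → ℝ} {g L : E → B} {X : E → E} {y : E} {c : ℝ}
    (hF : ContDiffAt ℝ ∞ F (y, g y)) (hg : ContDiffAt ℝ ∞ g y)
    (hL : DifferentiableAt ℝ L y) (hX : DifferentiableAt ℝ X y)
    (h : ∀ᶠ z in 𝓝 y, fderiv ℝ F (z, g z) (X z, fderiv ℝ g z (X z) - L z) = c * F (z, g z))
    (e : E) :
    fderiv ℝ (horDiff F) (y, g y, fderiv ℝ g y) (X y, fderiv ℝ g y (X y) - L y,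
      fderiv ℝ (fderiv ℝ g) y (X y) - fderiv ℝ L y) e =
      c * horDiff F (y, g y, fderiv ℝ g y) e
        - horDiff F (y, g y, fderiv ℝ g y) (fderiv ℝ X y e) := by
  have hF1 : DifferentiableAt ℝ F (y, g y) := hF.differentiableAt (by simp)
  have hg1 : DifferentiableAt ℝ g y := hg.differentiableAt (by simp)
  have hF2 : DifferentiableAt ℝ (fderiv ℝ F) (y, g y) :=
    (hF.fderiv_right (m := ∞) (by simp)).differentiableAt (by simp)
  have hg2 : DifferentiableAt ℝ (fderiv ℝ g) y :=
    (hg.fderiv_right (m := ∞) (by simp)).differentiableAt (by simp)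
  have hgr : HasFDerivAt (fun z ↦ (z, g z)) ((ContinuousLinearMap.id ℝ E).prod (fderiv ℝ g y)) y :=
    (hasFDerivAt_id y).prodMk hg1.hasFDerivAt
  -- `hl` and `hr` differentiate the two sides of `h` along the graph of `g`; `key` equates the
  -- results in the direction `e`.
  have hl := ((hF2.hasFDerivAt.comp y hgr).clm_apply
    (hX.hasFDerivAt.prodMk ((hg2.hasFDerivAt.clm_apply hX.hasFDerivAt).sub hL.hasFDerivAt))).fderiv
  have hr : fderiv ℝ (fun z ↦ c * F (z, g z)) y = c • horDiff F (y, g y, fderiv ℝ g y) := by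
    rw [← fderiv_comp_graph hF1 hg1]
    exact fderiv_const_mul (DifferentiableAt.comp (f := fun z ↦ (z, g z)) y hF1
      hgr.differentiableAt) c
  have key := congrArg (fun T : E →L[ℝ] ℝ ↦ T e) ((hl.symm.trans (Filter.EventuallyEq.fderiv_eq h)).trans hr)
  set q : E × B × (E →L[ℝ] B) := (y, g y, fderiv ℝ g y) with hq
  have hev : HasFDerivAt (fun z : E × B × (E →L[ℝ] B) ↦ horDiff F z e)
      ((fderiv ℝ (horDiff F) q).flip e) q := by
    have := ((contDiffAt_horDiff (q := q) hF).differentiableAt (by simp)).hasFDerivAt.clm_apply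
      (hasFDerivAt_const e q)
    simpa using this
  have hp : HasFDerivAt (fun z : E × B × (E →L[ℝ] B) ↦ (z.1, z.2.1))
      ((ContinuousLinearMap.fst ℝ E (B × (E →L[ℝ] B))).prod
        ((ContinuousLinearMap.fst ℝ B (E →L[ℝ] B)).comp (ContinuousLinearMap.snd ℝ E _))) q :=
    hasFDerivAt_fst.prodMk (hasFDerivAt_fst.comp q hasFDerivAt_snd)
  have hs : HasFDerivAt (fun z : E × B × (E →L[ℝ] B) ↦ (e, z.2.2 e))
      ((0 : E × B × (E →L[ℝ] B) →L[ℝ] E).prod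
        (((ContinuousLinearMap.snd ℝ B (E →L[ℝ] B)).comp
          (ContinuousLinearMap.snd ℝ E _)).flip e)) q := by
    refine (hasFDerivAt_const e q).prodMk ?_
    have := ((ContinuousLinearMap.snd ℝ B (E →L[ℝ] B)).comp
      (ContinuousLinearMap.snd ℝ E _)).hasFDerivAt.clm_apply (hasFDerivAt_const e q)
    simpa using this
  -- The product rule for `D F (e, ∂u e)`, whose value is `horDiff F` at `e`. It gives the same
  -- second-order terms as `key` with the two directions exchanged, which `symF` and `symg` repair.
  have hev' := (HasFDerivAt.comp q (f := fun z : E × B × (E →L[ℝ] B) ↦ (z.1, z.2.1))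
    hF2.hasFDerivAt hp).clm_apply hs
  have hA := congrArg (fun T : (E × B × (E →L[ℝ] B)) →L[ℝ] ℝ ↦ T (X y, fderiv ℝ g y (X y) - L y,
      fderiv ℝ (fderiv ℝ g) y (X y) - fderiv ℝ L y)) (hev.unique hev')
  have symF := (hF.isSymmSndFDerivAt (by simpa using two_le_infty)).eq
    (X y, fderiv ℝ g y (X y) - L y) (e, fderiv ℝ g y e)
  have symg := (hg.isSymmSndFDerivAt (by simpa using two_le_infty)).eq (X y) e
  simp [horDiff, q] at hA key symF symg ⊢
  rw [hA, symF, symg]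
  rw [← key, eq_sub_iff_add_eq, add_right_comm, ← map_add, Prod.mk_add_mk, zero_add]
  congr 3
  abel

theorem contDiffAt_covNormSq_horDiff [CompleteSpace E] {F : E × (E →L[ℝ] E →L[ℝ] ℝ) → ℝ}
    {q : E × (E →L[ℝ] E →L[ℝ] ℝ) × (E →L[ℝ] E →L[ℝ] E →L[ℝ] ℝ)}
    (hF : ContDiffAt ℝ ∞ F (q.1, q.2.1)) (hq : q.2.1.IsInvertible) :
    ContDiffAt ℝ ∞ (fun q : E × (E →L[ℝ] E →L[ℝ] ℝ) × (E →L[ℝ] E →L[ℝ] E →L[ℝ] ℝ) ↦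
      covNormSq q.2.1 (horDiff F q)) q := by
  have h1 : ContDiffAt ℝ ∞ (fun q : E × (E →L[ℝ] E →L[ℝ] ℝ) × (E →L[ℝ] E →L[ℝ] E →L[ℝ] ℝ) ↦
      q.2.1) q := by fun_prop
  have h2 := hq.contDiffAt_map_inverse.comp (n := ∞) (f := fun q : E × (E →L[ℝ] E →L[ℝ] ℝ) ×
    (E →L[ℝ] E →L[ℝ] E →L[ℝ] ℝ) ↦ q.2.1) q h1
  exact (contDiffAt_horDiff hF).clm_apply (h2.clm_apply (contDiffAt_horDiff hF))

/-- Put `α = horDiff F` and `N = u⁻¹α`. Differentiating `u(N, ·) = α` and `α(N)` and eliminating the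
derivative of `N` leaves `2c α(N)`: the terms in `T` cancel by symmetry of `u`. The inverse need
only be known to be differentiable. -/
theorem fderiv_covNormSq_horDiff [CompleteSpace E] {F : E × (E →L[ℝ] E →L[ℝ] ℝ) → ℝ}
    {q v : E × (E →L[ℝ] E →L[ℝ] ℝ) × (E →L[ℝ] E →L[ℝ] E →L[ℝ] ℝ)} {T : E →L[ℝ] E} {c : ℝ}
    (hF : ContDiffAt ℝ ∞ F (q.1, q.2.1)) (hq : q.2.1.IsInvertible)
    (hsymm : ∀ a b, q.2.1 a b = q.2.1 b a)
    (hv : ∀ a b, v.2.1 a b = - (q.2.1 (T a) b + q.2.1 a (T b)))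
    (hhor : ∀ e, fderiv ℝ (horDiff F) q v e = c * horDiff F q e - horDiff F q (T e)) :
    fderiv ℝ (fun q : E × (E →L[ℝ] E →L[ℝ] ℝ) × (E →L[ℝ] E →L[ℝ] E →L[ℝ] ℝ) ↦
      covNormSq q.2.1 (horDiff F q)) q v = 2 * c * covNormSq q.2.1 (horDiff F q) := by
  have hA : HasFDerivAt (horDiff F) (fderiv ℝ (horDiff F) q) q :=
    ((contDiffAt_horDiff hF).differentiableAt (by simp)).hasFDerivAt
  have hu : HasFDerivAt (fun q : E × (E →L[ℝ] E →L[ℝ] ℝ) × (E →L[ℝ] E →L[ℝ] E →L[ℝ] ℝ) ↦ q.2.1)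
      ((ContinuousLinearMap.fst ℝ (E →L[ℝ] E →L[ℝ] ℝ) (E →L[ℝ] E →L[ℝ] E →L[ℝ] ℝ)).comp
        (ContinuousLinearMap.snd ℝ E _)) q :=
    ((ContinuousLinearMap.fst ℝ (E →L[ℝ] E →L[ℝ] ℝ) (E →L[ℝ] E →L[ℝ] E →L[ℝ] ℝ)).comp
        (ContinuousLinearMap.snd ℝ E _)).hasFDerivAt
  have hi : DifferentiableAt ℝ (fun q : E × (E →L[ℝ] E →L[ℝ] ℝ) × (E →L[ℝ] E →L[ℝ] E →L[ℝ] ℝ) ↦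
      ContinuousLinearMap.inverse q.2.1) q :=
    DifferentiableAt.comp (g := ContinuousLinearMap.inverse)
      (f := fun q : E × (E →L[ℝ] E →L[ℝ] ℝ) × (E →L[ℝ] E →L[ℝ] E →L[ℝ] ℝ) ↦ q.2.1) q
      ((hq.contDiffAt_map_inverse (n := ∞)).differentiableAt (by simp)) hu.differentiableAt
  have hn := (hi.hasFDerivAt.clm_apply hA).differentiableAt.hasFDerivAt
  set N : E × (E →L[ℝ] E →L[ℝ] ℝ) × (E →L[ℝ] E →L[ℝ] E →L[ℝ] ℝ) → E :=
    fun q ↦ ContinuousLinearMap.inverse q.2.1 (horDiff F q) with hN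
  -- Invertibility is an open condition, so the equation defining `N` holds near `q` and can be
  -- differentiated.
  have hinv : ∀ᶠ z in 𝓝 q, z.2.1 (N z) = horDiff F z := by
    obtain ⟨e, he⟩ := hq
    have h1 : range ((↑) : (E ≃L[ℝ] (E →L[ℝ] ℝ)) → _) ∈ 𝓝 q.2.1 := by
      rw [← he]; exact ContinuousLinearEquiv.nhds e
    filter_upwards [hu.continuousAt h1] with z hz
    exact ContinuousLinearMap.IsInvertible.self_apply_inverse (f := z.2.1) hz _
  have hNq : q.2.1 (N q) = horDiff F q := hinv.self_of_nhds
  have h1 := congrArg (fun D : _ →L[ℝ] (E →L[ℝ] ℝ) ↦ D v (N q))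
    ((Filter.EventuallyEq.hasFDerivAt_iff hinv).1 (hu.clm_apply hn) |>.unique hA)
  have h2 := congrArg (fun D : _ →L[ℝ] ℝ ↦ D v) (hA.clm_apply hn).fderiv
  have h3 (e : E) : horDiff F q e = q.2.1 (N q) e := by rw [hNq]
  simp [hv, hhor] at h1 h2
  change fderiv ℝ (fun z ↦ horDiff F z (N z)) q v = 2 * c * horDiff F q (N q)
  rw [h2]
  simp only [h3] at h1 ⊢
  have h4 := hsymm (N q) (T (N q))
  have h5 := hsymm (N q) (fderiv ℝ N q v)
  linarith

end Horizontal

/-! ### Lorentzian forms -/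

section Lorentzian

variable {V W : Type*} [AddCommGroup V] [Module ℝ V] [TopologicalSpace V]
  [IsTopologicalAddGroup V] [ContinuousSMul ℝ V] [AddCommGroup W] [Module ℝ W] [TopologicalSpace W]
  [IsTopologicalAddGroup W] [ContinuousSMul ℝ W]

theorem IsLorentzian.symm {b : V →L[ℝ] V →L[ℝ] ℝ} (hb : IsLorentzian b) (v w : V) :
    b v w = b w v := by
  obtain ⟨m, e, he⟩ := hb
  have : (ContinuousLinearMap.coeLM ℝ).comp (b : V →ₗ[ℝ] (V →L[ℝ] ℝ)) =
      ((ContinuousLinearMap.coeLM ℝ).comp (b : V →ₗ[ℝ] (V →L[ℝ] ℝ))).flip := by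
    refine e.ext fun i ↦ e.ext fun j ↦ ?_
    simp only [LinearMap.comp_apply, LinearMap.flip_apply, ContinuousLinearMap.coeLM_apply,
      ContinuousLinearMap.coe_coe, he]
    by_cases h : i = j
    · rw [h]
    · rw [if_neg h, if_neg (Ne.symm h)]
  exact congrArg (fun T : V →ₗ[ℝ] V →ₗ[ℝ] ℝ ↦ T v w) this

theorem IsLorentzian.eq_zero {b : V →L[ℝ] V →L[ℝ] ℝ} (hb : IsLorentzian b) {v : V}
    (hv : ∀ w, b v w = 0) : v = 0 := by
  obtain ⟨m, e, he⟩ := hb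
  refine e.repr.map_eq_zero_iff.1 (Finsupp.ext fun j ↦ ?_)
  have h := hv (e j)
  rw [← e.sum_repr v] at h
  simp only [map_sum, map_smul, sum_apply, smul_apply, he,
    smul_eq_mul] at h
  rw [Finset.sum_eq_single j (fun i _ hij ↦ by simp [hij]) (by simp)] at h
  rw [if_pos rfl] at h
  split_ifs at h <;> simpa using h

theorem isInvertible_of_forall_eq_zero {E : Type*} [NormedAddCommGroup E] [NormedSpace ℝ E]
    [FiniteDimensional ℝ E] {b : E →L[ℝ] E →L[ℝ] ℝ} (hb : ∀ v, (∀ w, b v w = 0) → v = 0) :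
    b.IsInvertible := by
  have hinj : Function.Injective (b : E →ₗ[ℝ] (E →L[ℝ] ℝ)) :=
    (injective_iff_map_eq_zero _).2 fun v hv ↦ hb v fun w ↦ congrArg (fun T : E →L[ℝ] ℝ ↦ T w) hv
  have hdim : Module.finrank ℝ E = Module.finrank ℝ (E →L[ℝ] ℝ) := by
    rw [← (LinearMap.toContinuousLinearMap (𝕜 := ℝ) (E := E) (F' := ℝ)).finrank_eq]
    exact Subspace.dual_finrank_eq.symm
  refine ⟨(LinearEquiv.ofInjectiveOfFinrankEq (b : E →ₗ[ℝ] (E →L[ℝ] ℝ)) hinj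
    hdim).toContinuousLinearEquiv, ?_⟩
  ext v w
  rfl

/-- An isomorphism carrying one form and covector to the other also carries the vector dual to the
covector. -/
theorem covNormSq_congr {b : V →L[ℝ] V →L[ℝ] ℝ} {b' : W →L[ℝ] W →L[ℝ] ℝ} {α : V →L[ℝ] ℝ}
    {α' : W →L[ℝ] ℝ} (D : W ≃L[ℝ] V) (hb : b.IsInvertible) (hb' : b'.IsInvertible)
    (h : ∀ v w, b' v w = b (D v) (D w)) (hα : ∀ v, α' v = α (D v)) :
    covNormSq b α = covNormSq b' α' := by
  have h1 : b' (D.symm (b.inverse α)) = α' := by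
    ext w
    rw [h, D.apply_symm_apply, hb.self_apply_inverse, hα]
  rw [covNormSq, covNormSq, ← h1, hb'.inverse_apply_self, h1, hα, D.apply_symm_apply]

end Lorentzian

/-! ### Coordinate expressions -/

section Charts

variable {E : Type*} [NormedAddCommGroup E] [NormedSpace ℝ E]
  {M : Type*} [TopologicalSpace M] [ChartedSpace E M] [IsManifold 𝓘(ℝ, E) ∞ M]
  {φ : OpenPartialHomeomorph M E}

theorem mdifferentiable_of_mem_charts (hφ : φ ∈ charts E M) :
    φ.MDifferentiable 𝓘(ℝ, E) 𝓘(ℝ, E) :=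
  ⟨(contMDiffOn_of_mem_maximalAtlas hφ).mdifferentiableOn (by simp),
    (contMDiffOn_symm_of_mem_maximalAtlas hφ).mdifferentiableOn (by simp)⟩

theorem isInvertible_dsymm (hφ : φ ∈ charts E M) {y : E} (hy : y ∈ φ.target) :
    (dsymm φ y).IsInvertible :=
  haveI : IsManifold 𝓘(ℝ, E) 1 M := IsManifold.of_le (n := ∞) (by simp)
  ⟨(mdifferentiable_of_mem_charts hφ).symm.mfderiv hy, rfl⟩

theorem vfRep_apply (X : VField E M) (y : E) : vfRep φ X y = (dsymm φ y).inverse (X (φ.symm y)) :=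
  rfl

theorem dsymm_vfRep (hφ : φ ∈ charts E M) {y : E} (hy : y ∈ φ.target) (X : VField E M) :
    dsymm φ y (vfRep φ X y) = X (φ.symm y) := by
  rw [vfRep_apply, (isInvertible_dsymm hφ hy).self_apply_inverse]

theorem contDiffAt_vfRep [CompleteSpace E] (hφ : φ ∈ charts E M) {y : E} (hy : y ∈ φ.target)
    {X : VField E M} (hX : ContMDiff 𝓘(ℝ, E) 𝓘(ℝ, E).tangent ∞
      (fun x ↦ (⟨x, X x⟩ : TangentBundle 𝓘(ℝ, E) M))) : ContDiffAt ℝ ∞ (vfRep φ X) y := by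
  haveI : IsManifold 𝓘(ℝ, E) 1 M := IsManifold.of_le (n := ∞) (by simp)
  have h := ContMDiffAt.mpullback_vectorField_preimage (hX (φ.symm y))
    (contMDiffAt_symm_of_mem_maximalAtlas hφ hy) (isInvertible_dsymm hφ hy) (by simp)
  exact contMDiffAt_vectorSpace_iff_contDiffAt.1 h

theorem vfRep_mlieBracket [CompleteSpace E] (hφ : φ ∈ charts E M) {y : E} (hy : y ∈ φ.target)
    {X Y : VField E M} (hX : ContMDiff 𝓘(ℝ, E) 𝓘(ℝ, E).tangent ∞
      (fun x ↦ (⟨x, X x⟩ : TangentBundle 𝓘(ℝ, E) M)))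
    (hY : ContMDiff 𝓘(ℝ, E) 𝓘(ℝ, E).tangent ∞
      (fun x ↦ (⟨x, Y x⟩ : TangentBundle 𝓘(ℝ, E) M))) :
    vfRep φ (VectorField.mlieBracket 𝓘(ℝ, E) X Y) y =
      VectorField.lieBracket ℝ (vfRep φ X) (vfRep φ Y) y := by
  haveI : IsManifold 𝓘(ℝ, E) (minSmoothness ℝ 2) M :=
    IsManifold.of_le (n := ∞) (by simpa using two_le_infty)
  have h := VectorField.mpullback_mlieBracket (x₀ := y) (f := φ.symm)
    ((hX (φ.symm y)).mdifferentiableAt (by simp)) ((hY (φ.symm y)).mdifferentiableAt (by simp))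
    (contMDiffAt_symm_of_mem_maximalAtlas hφ hy) (by simpa using two_le_infty)
  rw [← VectorField.mlieBracketWithin_univ (I := 𝓘(ℝ, E)) (M := E),
    VectorField.mlieBracketWithin_eq_lieBracketWithin] at h
  exact h.trans (congrFun VectorField.lieBracketWithin_univ y)

theorem formRep_apply (y v w : E)
    (g : Π x : M, TangentSpace 𝓘(ℝ, E) x →L[ℝ] TangentSpace 𝓘(ℝ, E) x →L[ℝ] ℝ) :
    formRep φ g y v w = g (φ.symm y) (dsymm φ y v) (dsymm φ y w) := rfl

theorem formRep_vfRep (hφ : φ ∈ charts E M) {x : M} (hx : x ∈ φ.source)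
    (g : Π x : M, TangentSpace 𝓘(ℝ, E) x →L[ℝ] TangentSpace 𝓘(ℝ, E) x →L[ℝ] ℝ) (X Y : VField E M) :
    formRep φ g (φ x) (vfRep φ X (φ x)) (vfRep φ Y (φ x)) = g x (X x) (Y x) := by
  rw [formRep_apply, dsymm_vfRep hφ (φ.map_source hx), dsymm_vfRep hφ (φ.map_source hx),
    φ.left_inv hx]

/-- Matches the two descriptions of coordinate tangent vectors, by `(Dφ)⁻¹` at `x` and by `D(φ⁻¹)`
at `φ x`. The base points `x` and `φ.symm (φ x)` are only propositionally equal, so both sides are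
compared in the model space `E`. -/
theorem inverse_mfderiv_apply (hφ : φ ∈ charts E M) {x : M} (hx : x ∈ φ.source) (w : E) :
    ((mfderiv 𝓘(ℝ, E) 𝓘(ℝ, E) φ x).inverse w : E) = dsymm φ (φ x) w := by
  have hd := mdifferentiable_of_mem_charts hφ
  have h1 : (mfderiv 𝓘(ℝ, E) 𝓘(ℝ, E) φ x).IsInvertible := ⟨hd.mfderiv hx, rfl⟩
  have h2 := DFunLike.congr_fun (hd.symm_comp_deriv hx)
    ((mfderiv 𝓘(ℝ, E) 𝓘(ℝ, E) φ x).inverse w)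
  have h3 : dsymm φ (φ x) (mfderiv 𝓘(ℝ, E) 𝓘(ℝ, E) φ x
      ((mfderiv 𝓘(ℝ, E) 𝓘(ℝ, E) φ x).inverse w)) = dsymm φ (φ x) w :=
    congrArg (dsymm φ (φ x)) (h1.self_apply_inverse w)
  exact h2.symm.trans h3

theorem inverse_mfderiv_vfRep (hφ : φ ∈ charts E M) {x : M} (hx : x ∈ φ.source)
    (X : VField E M) :
    (mfderiv 𝓘(ℝ, E) 𝓘(ℝ, E) φ x).inverse (vfRep φ X (φ x) : E) = X x :=
  (inverse_mfderiv_apply hφ hx _).trans <| (dsymm_vfRep hφ (φ.map_source hx) X).trans <|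
    congrArg (fun z ↦ (X z : E)) (φ.left_inv hx)

theorem mvComp_wedge {r : ℕ} (K : Fin r → VField E M) (α : Fin r → Module.Dual ℝ E) (y : E) :
    mvComp φ (wedge K) α y = (Matrix.of fun i j ↦ α j (vfRep φ (K i) y)).det := by
  rw [mvComp, wedge, exteriorPower.map_apply_ιMulti, exteriorPower.pairingDual_ιMulti_ιMulti]
  rfl

theorem mvComp_smul {r : ℕ} (P : MVField E M r) (c : ℝ) (α : Fin r → Module.Dual ℝ E) (y : E) :
    mvComp φ (fun x ↦ c • P x) α y = c * mvComp φ P α y := by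
  simp only [mvComp, map_smul, smul_eq_mul]

end Charts

/-! ### The Lie derivative of a decomposable multivector field -/

section LieDerivative

variable {E : Type*} [NormedAddCommGroup E] [NormedSpace ℝ E] [FiniteDimensional ℝ E]
  {M : Type*} [TopologicalSpace M] [ChartedSpace E M] [IsManifold 𝓘(ℝ, E) ∞ M]
  {φ : OpenPartialHomeomorph M E} {r : ℕ}

theorem hasFDerivAt_mvComp_wedge {K : Fin r → VField E M} {y : E}
    (hK : ∀ i, DifferentiableAt ℝ (vfRep φ (K i)) y) (α : Fin r → Module.Dual ℝ E) :
    ∃ D : E →L[ℝ] ℝ, HasFDerivAt (mvComp φ (wedge K) α) D y ∧ ∀ v, D v =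
      ((Matrix.of fun i j ↦ α j (vfRep φ (K i) y)).adjugate *
        Matrix.of fun i j ↦ α j (fderiv ℝ (vfRep φ (K i)) y v)).trace := by
  have h := hasFDerivAt_det (A := fun z ↦ Matrix.of fun i j ↦ α j (vfRep φ (K i) z))
    (fun i j ↦ (α j).toContinuousLinearMap.hasFDerivAt.comp y (hK i).hasFDerivAt)
  have h2 : mvComp φ (wedge K) α = fun z ↦ (Matrix.of fun i j ↦ α j (vfRep φ (K i) z)).det :=
    funext (mvComp_wedge K α)
  rw [h2]
  exact h

theorem sum_mvComp_wedge_update (K : Fin r → VField E M) (α : Fin r → Module.Dual ℝ E) (y : E)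
    (T : E →ₗ[ℝ] E) :
    ∑ i, mvComp φ (wedge K) (Function.update α i (α i ∘ₗ T)) y =
      ((Matrix.of fun i j ↦ α j (vfRep φ (K i) y)).adjugate *
        Matrix.of fun i j ↦ α j (T (vfRep φ (K i) y))).trace := by
  rw [← sum_det_updateCol]
  refine Finset.sum_congr rfl fun i _ ↦ ?_
  rw [mvComp_wedge]
  congr 1
  ext a b
  by_cases h : b = i
  · subst h; simp
  · simp [h]

/-- `Dk(X)` enters through the rows and `DX(k)` through the columns; both sums are traces against
the same adjugate, so they combine into the brackets. -/
theorem lieDerivative_wedge {X : VField E M} {K : Fin r → VField E M} {y : E}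
    (hK : ∀ i, DifferentiableAt ℝ (vfRep φ (K i)) y) (α : Fin r → Module.Dual ℝ E) :
    fderiv ℝ (mvComp φ (wedge K) α) y (vfRep φ X y) - ∑ i, mvComp φ (wedge K)
        (Function.update α i (α i ∘ₗ (fderiv ℝ (vfRep φ X) y : E →ₗ[ℝ] E))) y =
      ((Matrix.of fun i j ↦ α j (vfRep φ (K i) y)).adjugate * Matrix.of fun i j ↦
        α j (VectorField.lieBracket ℝ (vfRep φ X) (vfRep φ (K i)) y)).trace := by
  obtain ⟨D, hD, hDv⟩ := hasFDerivAt_mvComp_wedge hK α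
  rw [hD.fderiv, hDv, sum_mvComp_wedge_update, ← Matrix.trace_sub, ← Matrix.mul_sub]
  congr 2
  ext i j
  simp [VectorField.lieBracket]

theorem vfRep_sum_smul (c : Fin r → ℝ) (K : Fin r → VField E M) (y : E) :
    vfRep φ (∑ l, c l • K l) y = ∑ l, c l • vfRep φ (K l) y := by
  have h : (∑ l, c l • K l) (φ.symm y) = ∑ l, c l • K l (φ.symm y) := by
    simp [Finset.sum_apply]
  rw [vfRep_apply, h]
  exact (map_sum _ _ _).trans (Finset.sum_congr rfl fun l _ ↦ map_smul _ _ _)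

theorem isLieDerivative_wedge {X : VField E M} {K : Fin r → VField E M} {c : Fin r → Fin r → ℝ}
    (hX : ContMDiff 𝓘(ℝ, E) 𝓘(ℝ, E).tangent ∞
      (fun x ↦ (⟨x, X x⟩ : TangentBundle 𝓘(ℝ, E) M)))
    (hK : ∀ i, ContMDiff 𝓘(ℝ, E) 𝓘(ℝ, E).tangent ∞
      (fun x ↦ (⟨x, K i x⟩ : TangentBundle 𝓘(ℝ, E) M)))
    (hc : ∀ i, VectorField.mlieBracket 𝓘(ℝ, E) X (K i) = ∑ l, c i l • K l) :
    IsLieDerivative X (wedge K) (fun x ↦ (∑ i, c i i) • wedge K x) := by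
  haveI : CompleteSpace E := FiniteDimensional.complete ℝ E
  intro φ hφ y hy α
  have hd (i) : DifferentiableAt ℝ (vfRep φ (K i)) y :=
    (contDiffAt_vfRep hφ hy (hK i)).differentiableAt (by simp)
  refine ⟨(hasFDerivAt_mvComp_wedge hd α).choose_spec.1.differentiableAt, ?_⟩
  rw [lieDerivative_wedge hd, mvComp_smul, mvComp_wedge]
  have h : (Matrix.of fun i j ↦ α j (VectorField.lieBracket ℝ (vfRep φ X) (vfRep φ (K i)) y)) =
      Matrix.of c * Matrix.of fun i j ↦ α j (vfRep φ (K i) y) := by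
    ext i j
    rw [Matrix.of_apply, ← vfRep_mlieBracket hφ hy hX (hK i), hc, vfRep_sum_smul, map_sum,
      Matrix.mul_apply]
    simp
  -- With `A = (αⱼ(kᵢ))`, cyclicity of the trace gives `tr(adj A · c · A) = tr(A · adj A · c) = det
  -- A · tr c`.
  rw [h, ← Matrix.mul_assoc, Matrix.trace_mul_cycle, Matrix.mul_adjugate, Matrix.smul_mul,
    Matrix.one_mul, Matrix.trace_smul, smul_eq_mul, mul_comm]
  rfl

theorem IsLieDerivative.gram_weight {X : VField E M} {K : Fin r → VField E M} {l : ℝ}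
    (h : IsLieDerivative X (wedge K) (fun x ↦ l • wedge K x)) (hφ : φ ∈ charts E M) {y : E}
    (hy : y ∈ φ.target) (hK : ∀ i, DifferentiableAt ℝ (vfRep φ (K i)) y)
    (u : E →L[ℝ] E →L[ℝ] ℝ) :
    fderiv ℝ (gram fun i ↦ vfRep φ (K i)) (y, u) (vfRep φ X y,
      -(u.bilinearComp (fderiv ℝ (vfRep φ X) y) (ContinuousLinearMap.id ℝ E)
        + u.bilinearComp (ContinuousLinearMap.id ℝ E) (fderiv ℝ (vfRep φ X) y))) =
      2 * l * gram (fun i ↦ vfRep φ (K i)) (y, u) := by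
  refine fderiv_gram_lie hK (fun α ↦ ?_) u
  rw [← lieDerivative_wedge hK, ← (h φ hφ y hy α).2, mvComp_smul, mvComp_wedge]

/-- The weight is the trace of the adjoint action on `𝔦`, in the basis `K`. It is linear in `X`
because the bracket is linear on differentiable fields. -/
theorem exists_weight {𝔤 : VFLieAlgebra E M} {𝔦 : Submodule ℝ (VField E M)} (h𝔦 : IsIdeal 𝔤 𝔦)
    {K : Fin r → VField E M} (hK : LinearIndependent ℝ K)
    (hspan : Submodule.span ℝ (Set.range K) = 𝔦) :
    ∃ lam : Module.Dual ℝ 𝔤.toSubmodule, ∀ X : 𝔤.toSubmodule,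
      IsLieDerivative X.1 (wedge K) (fun x ↦ lam X • wedge K x) := by
  haveI : CompleteSpace E := FiniteDimensional.complete ℝ E
  haveI : IsManifold 𝓘(ℝ, E) (minSmoothness ℝ 2) M :=
    IsManifold.of_le (n := ∞) (by simpa using two_le_infty)
  haveI : IsManifold 𝓘(ℝ, E) 2 M := IsManifold.of_le (n := ∞) two_le_infty
  subst hspan
  have hKi (i) : K i ∈ Submodule.span ℝ (Set.range K) := Submodule.subset_span ⟨i, rfl⟩
  let b := Module.Basis.span hK
  let ad (i : Fin r) : 𝔤.toSubmodule →ₗ[ℝ] Submodule.span ℝ (Set.range K) :=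
    { toFun X := ⟨VectorField.mlieBracket 𝓘(ℝ, E) X.1 (K i), h𝔦.2 X.1 X.2 (K i) (hKi i)⟩
      map_add' X Y := Subtype.ext <| funext fun x ↦ VectorField.mlieBracket_add_left
        ((𝔤.smooth X.1 X.2 x).mdifferentiableAt (by simp))
        ((𝔤.smooth Y.1 Y.2 x).mdifferentiableAt (by simp))
      map_smul' a X := Subtype.ext <| funext fun x ↦ VectorField.mlieBracket_const_smul_left
        ((𝔤.smooth X.1 X.2 x).mdifferentiableAt (by simp)) }
  refine ⟨∑ i, b.coord i ∘ₗ ad i, fun X ↦ ?_⟩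
  have h := isLieDerivative_wedge (c := fun i l ↦ b.repr (ad i X) l) (𝔤.smooth X.1 X.2)
    (fun i ↦ 𝔤.smooth (K i) (h𝔦.1 (hKi i))) (fun i ↦ by
      have h1 := congrArg Subtype.val (b.sum_repr (ad i X))
      rw [← show (ad i X : VField E M) = VectorField.mlieBracket 𝓘(ℝ, E) X.1 (K i) from rfl, ← h1]
      simp [b, Module.Basis.span_apply])
  simpa using h

end LieDerivative

/-! ### Functions on jet spaces in coordinates -/

section Jets

variable {E : Type*} [NormedAddCommGroup E] [NormedSpace ℝ E] [FiniteDimensional ℝ E]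
  {M : Type*} [TopologicalSpace M] [ChartedSpace E M] [IsManifold 𝓘(ℝ, E) ∞ M]
  {φ : OpenPartialHomeomorph M E} {r k : ℕ}

theorem chartAt_mem_charts (x : M) : chartAt E x ∈ charts E M :=
  IsManifold.chart_mem_maximalAtlas x

theorem Jet.pt_mem_dom (θ : Jet E M k) : θ.pt ∈ θ.rep.dom := (Quotient.out θ.jet).2

/-- The representative chosen for the jet need not be `g`, but it agrees with `g` to order zero at
`x`; this lets `R ∘ j⁰g` be computed from `g` itself. -/
theorem LocalMetric.formRep_rep_jet (g : LocalMetric E M) {x : M} (hx : x ∈ g.dom)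
    (hφ : φ ∈ charts E M) (hxφ : x ∈ φ.source) :
    formRep φ (g.jet k x hx).rep.toFun (φ x) = formRep φ g.toFun (φ x) := by
  have h : (jetSetoid E M k x).r (Quotient.out (g.jet k x hx).jet) ⟨g, hx⟩ :=
    Quotient.exact (Quotient.out_eq (Quotient.mk (jetSetoid E M k x) ⟨g, hx⟩))
  have h1 := congrArg (fun T ↦ T 0) (h φ hφ hxφ 0 (Nat.zero_le k))
  simp only [iteratedFDeriv_zero_apply] at h1
  exact h1

/-- The prolongation of `Kᵢ` projects to `Kᵢ`, and the horizontal form sees only this projection. -/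
theorem RFun_eq_det (K : Fin r → VField E M) (θ : Jet E M 0) :
    RFun K θ = (Matrix.of fun i j ↦ θ.form (K i θ.pt) (K j θ.pt)).det := by
  rw [RFun, mvNormSq, exteriorPower.map_apply_ιMulti, exteriorPower.pairingDual_ιMulti_ιMulti,
    ← Matrix.det_transpose]
  congr 1
  ext i j
  have h (i) : θ.dproj (chartAt E θ.pt) (prolong (chartAt E θ.pt) (K i) θ) = K i θ.pt :=
    inverse_mfderiv_vfRep (chartAt_mem_charts θ.pt) (mem_chart_source E θ.pt) (K i)
  exact congrArg₂ (fun v w ↦ θ.form v w) (h i) (h j)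

/-- Frees `R` from the preferred chart in its definition: the Gram determinant computes it in every
chart around the base point. -/
theorem RFun_eq_gram (K : Fin r → VField E M) (θ : Jet E M 0) (hφ : φ ∈ charts E M)
    (hθ : θ.pt ∈ φ.source) :
    RFun K θ = gram (fun i ↦ vfRep φ (K i)) (φ θ.pt, formRep φ θ.rep.toFun (φ θ.pt)) := by
  rw [RFun_eq_det, gram]
  congr 1
  ext i j
  exact (formRep_vfRep hφ hθ θ.rep.toFun (K i) (K j)).symm

theorem pullFun_RFun (K : Fin r → VField E M) (g : LocalMetric E M) (hφ : φ ∈ charts E M)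
    {y : E} (hy : y ∈ φ.target) (hg : φ.symm y ∈ g.dom) :
    pullFun (RFun K) g (φ.symm y) = gram (fun i ↦ vfRep φ (K i)) (y, formRep φ g.toFun y) := by
  rw [pullFun, dif_pos hg, RFun_eq_gram K _ hφ (φ.map_target hy)]
  change gram (fun i ↦ vfRep φ (K i)) (φ (φ.symm y), formRep φ (g.jet 0 (φ.symm y) hg).rep.toFun
    (φ (φ.symm y))) = _
  rw [g.formRep_rep_jet hg hφ (φ.map_target hy), φ.right_inv hy]

theorem LocalMetric.contDiffAt_formRep (g : LocalMetric E M) (hφ : φ ∈ charts E M)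
    {y : E} (hy : y ∈ φ.target) (hg : φ.symm y ∈ g.dom) :
    ContDiffAt ℝ ∞ (formRep φ g.toFun) y :=
  (g.smooth φ hφ).contDiffAt ((φ.symm.isOpen_inter_preimage g.isOpen_dom).mem_nhds ⟨hy, hg⟩)

theorem LocalMetric.eventually_mem (g : LocalMetric E M)
    {y : E} (hy : y ∈ φ.target) (hg : φ.symm y ∈ g.dom) :
    ∀ᶠ z in 𝓝 y, z ∈ φ.target ∧ φ.symm z ∈ g.dom :=
  (φ.symm.isOpen_inter_preimage g.isOpen_dom).mem_nhds ⟨hy, hg⟩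

theorem Jet.isInvertible_formRep (θ : Jet E M k) (hφ : φ ∈ charts E M) (hθ : θ.pt ∈ φ.source) :
    (formRep φ θ.rep.toFun (φ θ.pt)).IsInvertible := by
  refine isInvertible_of_forall_eq_zero fun v hv ↦ ?_
  have hinv := isInvertible_dsymm hφ (φ.map_source hθ)
  have hl := θ.rep.lorentzian (φ.symm (φ θ.pt)) (by rw [φ.left_inv hθ]; exact θ.pt_mem_dom)
  have h : dsymm φ (φ θ.pt) v = 0 := hl.eq_zero fun w ↦ by
    have h1 := hv ((dsymm φ (φ θ.pt)).inverse w)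
    rw [formRep_apply, hinv.self_apply_inverse] at h1
    exact h1
  rw [← hinv.inverse_apply_self v, h, map_zero]

theorem Jet.formRep_symm (θ : Jet E M k) (hθ : θ.pt ∈ φ.source) (v w : E) :
    formRep φ θ.rep.toFun (φ θ.pt) v w = formRep φ θ.rep.toFun (φ θ.pt) w v :=
  (θ.rep.lorentzian (φ.symm (φ θ.pt)) (by rw [φ.left_inv hθ]; exact θ.pt_mem_dom)).symm _ _

end Jets

/-! ### Coordinates on the jet spaces of order zero and one -/

section LowOrder

variable {E : Type*} [NormedAddCommGroup E] [NormedSpace ℝ E] [FiniteDimensional ℝ E]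
  {M : Type*} [TopologicalSpace M] [ChartedSpace E M] [IsManifold 𝓘(ℝ, E) ∞ M]
  {φ : OpenPartialHomeomorph M E} {r k : ℕ}

theorem Jet.isInvertible_form (θ : Jet E M k) : θ.form.IsInvertible :=
  isInvertible_of_forall_eq_zero (E := E) (b := θ.form) fun _ hv ↦
    (θ.rep.lorentzian θ.pt θ.pt_mem_dom).eq_zero hv

theorem Jet.formRep_eq_form (θ : Jet E M k) (hφ : φ ∈ charts E M) (hθ : θ.pt ∈ φ.source)
    (v w : E) :
    formRep φ θ.rep.toFun (φ θ.pt) v w =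
      θ.form (((mdifferentiable_of_mem_charts hφ).mfderiv hθ).symm v)
        (((mdifferentiable_of_mem_charts hφ).mfderiv hθ).symm w) := by
  have h (z : M) (hz : z = θ.pt) (v w : E) : θ.rep.toFun z v w = θ.form v w := by
    subst hz; rfl
  exact h _ (φ.left_inv hθ) _ _

theorem contDiffAt_gram_vfRep {K : Fin r → VField E M} (hφ : φ ∈ charts E M)
    (hK : ∀ i, ContMDiff 𝓘(ℝ, E) 𝓘(ℝ, E).tangent ∞
      (fun x ↦ (⟨x, K i x⟩ : TangentBundle 𝓘(ℝ, E) M)))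
    {p : E × (E →L[ℝ] E →L[ℝ] ℝ)} (hp : p.1 ∈ φ.target) :
    ContDiffAt ℝ ∞ (gram fun i ↦ vfRep φ (K i)) p :=
  haveI : CompleteSpace E := FiniteDimensional.complete ℝ E
  contDiffAt_gram fun i ↦ contDiffAt_vfRep hφ hp (hK i)

theorem horDiff_gram_eq_hdiff_RFun {K : Fin r → VField E M} (θ : Jet E M 1) (hφ : φ ∈ charts E M)
    (hK : ∀ i, ContMDiff 𝓘(ℝ, E) 𝓘(ℝ, E).tangent ∞
      (fun x ↦ (⟨x, K i x⟩ : TangentBundle 𝓘(ℝ, E) M)))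
    (hθ : θ.pt ∈ φ.source) (v : E) :
    horDiff (gram fun i ↦ vfRep φ (K i)) (φ θ.pt, formRep φ θ.rep.toFun (φ θ.pt),
        fderiv ℝ (formRep φ θ.rep.toFun) (φ θ.pt)) v =
      hdiff (RFun K) θ (((mdifferentiable_of_mem_charts hφ).mfderiv hθ).symm v) := by
  have hd := mdifferentiable_of_mem_charts hφ
  set g := formRep φ θ.rep.toFun with hg
  have ht := φ.map_source hθ
  have hdom : φ.symm (φ θ.pt) ∈ θ.rep.dom := by rw [φ.left_inv hθ]; exact θ.pt_mem_dom
  have hF := (contDiffAt_gram_vfRep (p := (φ θ.pt, g (φ θ.pt))) hφ hK ht).differentiableAt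
    (by simp)
  have hgd : DifferentiableAt ℝ g (φ θ.pt) :=
    (θ.rep.contDiffAt_formRep hφ ht hdom).differentiableAt (by simp)
  have hcomp : DifferentiableAt ℝ (fun z ↦ gram (fun i ↦ vfRep φ (K i)) (z, g z)) (φ θ.pt) :=
    DifferentiableAt.comp (f := fun z ↦ (z, g z)) _ hF (differentiableAt_id.prodMk hgd)
  have hev : (pullFun (RFun K) θ.rep) ∘ φ.symm =ᶠ[𝓝 (φ θ.pt)]
      fun z ↦ gram (fun i ↦ vfRep φ (K i)) (z, g z) := by
    filter_upwards [θ.rep.eventually_mem ht hdom] with z hz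
    exact pullFun_RFun K θ.rep hφ hz.1 hz.2
  have hev' : pullFun (RFun K) θ.rep =ᶠ[𝓝 θ.pt]
      (fun z ↦ gram (fun i ↦ vfRep φ (K i)) (z, g z)) ∘ φ := by
    filter_upwards [(φ.continuousAt hθ).eventually hev, φ.open_source.mem_nhds hθ] with x hx hxs
    simpa [φ.left_inv hxs] using hx
  -- Needed before the chain rule: `mfderiv` is zero by default where the function is not
  -- differentiable.
  have hdiffR : MDifferentiableAt 𝓘(ℝ, E) 𝓘(ℝ, ℝ) (pullFun (RFun K) θ.rep) θ.pt :=
    (hcomp.mdifferentiableAt.comp θ.pt (hd.mdifferentiableAt hθ)).congr_of_eventuallyEq hev'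
  have h1 := mfderiv_comp_of_eq hdiffR (hd.mdifferentiableAt_symm ht) (φ.left_inv hθ)
  rw [← fderiv_comp_graph hF hgd, ← hev.fderiv_eq, ← mfderiv_eq_fderiv, h1]
  exact congrArg (fun z ↦ (mfderiv 𝓘(ℝ, E) 𝓘(ℝ, ℝ) (pullFun (RFun K) θ.rep) z : E →L[ℝ] ℝ)
    (dsymm φ (φ θ.pt) v)) (φ.left_inv hθ)

theorem SFun_eq_covNormSq {K : Fin r → VField E M} (θ : Jet E M 1) (hφ : φ ∈ charts E M)
    (hK : ∀ i, ContMDiff 𝓘(ℝ, E) 𝓘(ℝ, E).tangent ∞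
      (fun x ↦ (⟨x, K i x⟩ : TangentBundle 𝓘(ℝ, E) M)))
    (hθ : θ.pt ∈ φ.source) :
    SFun K θ = covNormSq (formRep φ θ.rep.toFun (φ θ.pt))
      (horDiff (gram fun i ↦ vfRep φ (K i)) (φ θ.pt, formRep φ θ.rep.toFun (φ θ.pt),
        fderiv ℝ (formRep φ θ.rep.toFun) (φ θ.pt))) :=
  covNormSq_congr ((mdifferentiable_of_mem_charts hφ).mfderiv hθ).symm θ.isInvertible_form
    (θ.isInvertible_formRep hφ hθ) (θ.formRep_eq_form hφ hθ)
    (horDiff_gram_eq_hdiff_RFun θ hφ hK hθ)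

/-- Continuous multilinear maps in no variable, as a continuous linear map. -/
def curryZero (E F : Type*) [NormedAddCommGroup E] [NormedSpace ℝ E] [NormedAddCommGroup F]
    [NormedSpace ℝ F] : ContinuousMultilinearMap ℝ (fun _ : Fin 0 ↦ E) F →L[ℝ] F :=
  ((continuousMultilinearCurryFin0 ℝ E F).toContinuousLinearEquiv : _ →L[ℝ] F)

/-- Continuous multilinear maps in one variable, as a continuous linear map. -/
def curryOne (E F : Type*) [NormedAddCommGroup E] [NormedSpace ℝ E] [NormedAddCommGroup F]
    [NormedSpace ℝ F] : ContinuousMultilinearMap ℝ (fun _ : Fin 1 ↦ E) F →L[ℝ] E →L[ℝ] F :=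
  ((continuousMultilinearCurryFin1 ℝ E F).toContinuousLinearEquiv : _ →L[ℝ] E →L[ℝ] F)

/-- The derivatives of order `i` of a jet in coordinates. -/
def jetCoordProj (E : Type*) [NormedAddCommGroup E] [NormedSpace ℝ E] (k : ℕ) (i : Fin (k + 1)) :
    JetCoord E k →L[ℝ] ContinuousMultilinearMap ℝ (fun _ : Fin i ↦ E) (E →L[ℝ] E →L[ℝ] ℝ) :=
  (ContinuousLinearMap.proj (φ := fun i : Fin (k + 1) ↦
    ContinuousMultilinearMap ℝ (fun _ : Fin i ↦ E) (E →L[ℝ] E →L[ℝ] ℝ)) i).comp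
      (ContinuousLinearMap.snd ℝ _ _)

/-- The coordinates `(x, u)` on `J⁰π`. -/
def jetCoordZero (E : Type*) [NormedAddCommGroup E] [NormedSpace ℝ E] :
    JetCoord E 0 →L[ℝ] E × (E →L[ℝ] E →L[ℝ] ℝ) :=
  (ContinuousLinearMap.fst ℝ _ _).prod ((curryZero E _).comp (jetCoordProj E 0 0))

/-- The coordinates `(x, u, ∂u)` on `J¹π`. -/
def jetCoordOne (E : Type*) [NormedAddCommGroup E] [NormedSpace ℝ E] :
    JetCoord E 1 →L[ℝ] E × (E →L[ℝ] E →L[ℝ] ℝ) × (E →L[ℝ] E →L[ℝ] E →L[ℝ] ℝ) :=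
  (ContinuousLinearMap.fst ℝ _ _).prod
    (((curryZero E _).comp (jetCoordProj E 1 0)).prod ((curryOne E _).comp (jetCoordProj E 1 1)))

theorem curryFin0_iteratedFDeriv {F : Type*} [NormedAddCommGroup F] [NormedSpace ℝ F]
    (g : E → F) (y : E) :
    continuousMultilinearCurryFin0 ℝ E F (iteratedFDeriv ℝ 0 g y) = g y := by
  simp

theorem curryFin1_iteratedFDeriv {F : Type*} [NormedAddCommGroup F] [NormedSpace ℝ F]
    (g : E → F) (y : E) :
    continuousMultilinearCurryFin1 ℝ E F (iteratedFDeriv ℝ 1 g y) = fderiv ℝ g y := by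
  ext v
  simp

theorem curryFin0_fderiv_iteratedFDeriv {F : Type*} [NormedAddCommGroup F] [NormedSpace ℝ F]
    (g : E → F) (y v : E) :
    continuousMultilinearCurryFin0 ℝ E F (fderiv ℝ (iteratedFDeriv ℝ 0 g) y v) =
      fderiv ℝ g y v := by
  have h := (continuousMultilinearCurryFin0 ℝ E F).toContinuousLinearEquiv.comp_fderiv
    (f := iteratedFDeriv ℝ 0 g) (x := y)
  have h2 : (continuousMultilinearCurryFin0 ℝ E F).toContinuousLinearEquiv ∘
    iteratedFDeriv ℝ 0 g = g := funext (curryFin0_iteratedFDeriv g)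
  rw [h2] at h
  rw [h]
  rfl

theorem curryFin1_fderiv_iteratedFDeriv {F : Type*} [NormedAddCommGroup F] [NormedSpace ℝ F]
    (g : E → F) (y v : E) :
    continuousMultilinearCurryFin1 ℝ E F (fderiv ℝ (iteratedFDeriv ℝ 1 g) y v) =
      fderiv ℝ (fderiv ℝ g) y v := by
  have h := (continuousMultilinearCurryFin1 ℝ E F).toContinuousLinearEquiv.comp_fderiv
    (f := iteratedFDeriv ℝ 1 g) (x := y)
  have h2 : (continuousMultilinearCurryFin1 ℝ E F).toContinuousLinearEquiv ∘
    iteratedFDeriv ℝ 1 g = fderiv ℝ g := funext (curryFin1_iteratedFDeriv g)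
  rw [h2] at h
  rw [h]
  rfl

theorem jetCoordZero_coord (θ : Jet E M 0) :
    jetCoordZero E (θ.coord φ) = (φ θ.pt, formRep φ θ.rep.toFun (φ θ.pt)) :=
  Prod.ext rfl (curryFin0_iteratedFDeriv _ _)

theorem jetCoordOne_coord (θ : Jet E M 1) :
    jetCoordOne E (θ.coord φ) = (φ θ.pt, formRep φ θ.rep.toFun (φ θ.pt),
      fderiv ℝ (formRep φ θ.rep.toFun) (φ θ.pt)) :=
  Prod.ext rfl (Prod.ext (curryFin0_iteratedFDeriv _ _) (curryFin1_iteratedFDeriv _ _))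

theorem jetCoordZero_prolong (X : VField E M) (θ : Jet E M 0) :
    jetCoordZero E (prolong φ X θ) = (vfRep φ X (φ θ.pt),
      fderiv ℝ (formRep φ θ.rep.toFun) (φ θ.pt) (vfRep φ X (φ θ.pt))
        - lieForm (vfRep φ X) (formRep φ θ.rep.toFun) (φ θ.pt)) := by
  refine Prod.ext rfl ?_
  refine (map_sub (continuousMultilinearCurryFin0 ℝ E (E →L[ℝ] E →L[ℝ] ℝ)) _ _).trans ?_
  exact congrArg₂ (· - ·) (curryFin0_fderiv_iteratedFDeriv _ _ _) (curryFin0_iteratedFDeriv _ _)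

theorem jetCoordOne_prolong (X : VField E M) (θ : Jet E M 1) :
    jetCoordOne E (prolong φ X θ) = (vfRep φ X (φ θ.pt),
      fderiv ℝ (formRep φ θ.rep.toFun) (φ θ.pt) (vfRep φ X (φ θ.pt))
        - lieForm (vfRep φ X) (formRep φ θ.rep.toFun) (φ θ.pt),
      fderiv ℝ (fderiv ℝ (formRep φ θ.rep.toFun)) (φ θ.pt) (vfRep φ X (φ θ.pt))
        - fderiv ℝ (lieForm (vfRep φ X) (formRep φ θ.rep.toFun)) (φ θ.pt)) := by
  refine Prod.ext rfl (Prod.ext ?_ ?_)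
  · refine (map_sub (continuousMultilinearCurryFin0 ℝ E (E →L[ℝ] E →L[ℝ] ℝ)) _ _).trans ?_
    exact congrArg₂ (· - ·) (curryFin0_fderiv_iteratedFDeriv _ _ _) (curryFin0_iteratedFDeriv _ _)
  · refine (map_sub (continuousMultilinearCurryFin1 ℝ E (E →L[ℝ] E →L[ℝ] ℝ)) _ _).trans ?_
    exact congrArg₂ (· - ·) (curryFin1_fderiv_iteratedFDeriv _ _ _) (curryFin1_iteratedFDeriv _ _)

theorem fderiv_comp_clm {V W : Type*} [NormedAddCommGroup V] [NormedSpace ℝ V]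
    [NormedAddCommGroup W] [NormedSpace ℝ W] {F : W → ℝ} {T : V →L[ℝ] W} {x : V}
    (h : DifferentiableAt ℝ F (T x)) (v : V) :
    fderiv ℝ (fun z ↦ F (T z)) x v = fderiv ℝ F (T x) (T v) :=
  congrArg (fun D : V →L[ℝ] ℝ ↦ D v) (h.hasFDerivAt.comp x T.hasFDerivAt).fderiv

theorem isSmoothFun_of_coord {N : Set (Jet E M k)} {f : N → ℝ}
    {W : OpenPartialHomeomorph M E → Set (JetCoord E k)}
    {F : OpenPartialHomeomorph M E → JetCoord E k → ℝ} (hW : ∀ φ ∈ charts E M, IsOpen (W φ))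
    (hF : ∀ φ ∈ charts E M, ∀ q ∈ W φ, ContDiffAt ℝ ∞ (F φ) q)
    (hmem : ∀ φ ∈ charts E M, ∀ η : N, η.1.pt ∈ φ.source → η.1.coord φ ∈ W φ)
    (hf : ∀ φ ∈ charts E M, ∀ η : N, η.1.pt ∈ φ.source → f η = F φ (η.1.coord φ)) :
    IsSmoothFun f := fun θ φ hφ hθ ↦
  ⟨W φ, F φ, hW φ hφ, hmem φ hφ θ hθ, fun q hq ↦ (hF φ hφ q hq).contDiffWithinAt,
    fun η hη _ ↦ hf φ hφ η hη⟩

/-- By the chain rule a curve enters only through its velocity. Continuity of its base point keeps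
it in the chart domain for small times, where `F` represents `f`. -/
theorem hasDerivAlong_of_coord {N : Set (Jet E M k)} {f : N → ℝ} {X : VField E M} {θ : N} {c : ℝ}
    {F : JetCoord E k → ℝ} (hX : IsTangentAt N X θ.1) (hφ : φ ∈ charts E M)
    (hθ : θ.1.pt ∈ φ.source) (hF : DifferentiableAt ℝ F (θ.1.coord φ))
    (hf : ∀ η : N, η.1.pt ∈ φ.source → f η = F (η.1.coord φ))
    (hc : fderiv ℝ F (θ.1.coord φ) (prolong φ X θ.1) = c) : HasDerivAlong X f c θ := by
  refine ⟨hX, fun γ ⟨hγ0, hγc, hγ⟩ ↦ ?_⟩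
  have hγ1 : γ 0 = θ := Subtype.ext hγ0
  subst hγ1
  have hsrc : φ.source ∈ 𝓝 (γ 0).1.pt := φ.open_source.mem_nhds hθ
  have h1 := HasFDerivAt.comp_hasDerivAt (f := fun t ↦ (γ t).1.coord φ) 0
    hF.hasFDerivAt (hγ φ hφ hθ)
  rw [← hc]
  refine h1.congr_of_eventuallyEq ?_
  filter_upwards [hγc hsrc] with t ht
  exact hf (γ t) ht

end LowOrder

/-! ### The relative invariants -/

section Main

variable {E : Type*} [NormedAddCommGroup E] [NormedSpace ℝ E] [FiniteDimensional ℝ E]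
  {M : Type*} [TopologicalSpace M] [ChartedSpace E M] [IsManifold 𝓘(ℝ, E) ∞ M]
  {φ : OpenPartialHomeomorph M E} {r k : ℕ}

/-- On `J⁰π`, the prolongation of `X` multiplies `R` by `2 * l`. -/
theorem IsLieDerivative.gram_prolong {X : VField E M} {K : Fin r → VField E M} {l : ℝ}
    (h : IsLieDerivative X (wedge K) (fun x ↦ l • wedge K x)) (hφ : φ ∈ charts E M)
    (hK : ∀ i, ContMDiff 𝓘(ℝ, E) 𝓘(ℝ, E).tangent ∞
      (fun x ↦ (⟨x, K i x⟩ : TangentBundle 𝓘(ℝ, E) M)))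
    {y : E} (hy : y ∈ φ.target) (g : E → E →L[ℝ] E →L[ℝ] ℝ) :
    fderiv ℝ (gram fun i ↦ vfRep φ (K i)) (y, g y)
      (vfRep φ X y, fderiv ℝ g y (vfRep φ X y) - lieForm (vfRep φ X) g y) =
      2 * l * gram (fun i ↦ vfRep φ (K i)) (y, g y) := by
  haveI : CompleteSpace E := FiniteDimensional.complete ℝ E
  rw [← h.gram_weight hφ hy (fun i ↦ (contDiffAt_vfRep hφ hy (hK i)).differentiableAt (by simp))]
  congr 2
  -- `L_X g` contains the derivative of `g` along `X`, which cancels; no differentiability of `g` is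
  -- required.
  rw [lieForm]
  abel

theorem differentiableAt_lieForm {X : E → E} {g : E → E →L[ℝ] E →L[ℝ] ℝ} {y : E}
    (hX : ContDiffAt ℝ ∞ X y) (hg : ContDiffAt ℝ ∞ g y) : DifferentiableAt ℝ (lieForm X g) y := by
  have h1 : DifferentiableAt ℝ X y := hX.differentiableAt (by simp)
  have h2 : DifferentiableAt ℝ g y := hg.differentiableAt (by simp)
  have h3 : DifferentiableAt ℝ (fderiv ℝ X) y :=
    (hX.fderiv_right (m := ∞) (by simp)).differentiableAt (by simp)
  have h4 : DifferentiableAt ℝ (fderiv ℝ g) y :=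
    (hg.fderiv_right (m := ∞) (by simp)).differentiableAt (by simp)
  -- Ordinary compositions replace `bilinearComp`, so that the product rule for composition applies.
  have e1 (z : E) : (g z).bilinearComp (fderiv ℝ X z) (ContinuousLinearMap.id ℝ E) =
      (g z).comp (fderiv ℝ X z) := by ext; rfl
  have e2 (z : E) : (g z).bilinearComp (ContinuousLinearMap.id ℝ E) (fderiv ℝ X z) =
      ((ContinuousLinearMap.compL ℝ E E ℝ).flip (fderiv ℝ X z)).comp (g z) := by ext; rfl
  unfold lieForm
  simp only [e1, e2]
  exact ((h4.clm_apply h1).add (h2.clm_comp h3)).add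
    ((((ContinuousLinearMap.compL ℝ E E ℝ).flip.differentiableAt.comp y h3)).clm_comp h2)

theorem isRelativeInvariant_RFun {ℰ : JetPDE E M} {𝔤 : VFLieAlgebra E M}
    (h𝔤 : IsSymmetryAlgebra 𝔤 ℰ) {K : Fin r → VField E M}
    (hK : ∀ i, K i ∈ 𝔤.toSubmodule) {lam : Module.Dual ℝ 𝔤.toSubmodule}
    (hlam : ∀ X : 𝔤.toSubmodule,
      IsLieDerivative X.1 (wedge K) (fun x ↦ lam X • wedge K x)) :
    IsRelativeInvariant 𝔤 ℰ 0 (fun θ ↦ RFun K θ.1) ((2 : ℝ) • lam) := by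
  have hKs i := 𝔤.smooth (K i) (hK i)
  have hR (φ) (hφ : φ ∈ charts E M) (η : ℰ.eqn 0) (hη : η.1.pt ∈ φ.source) : RFun K η.1 =
      (gram fun i ↦ vfRep φ (K i)) (jetCoordZero E (η.1.coord φ)) := by
    rw [jetCoordZero_coord, RFun_eq_gram K _ hφ hη]
  have hC (φ) (hφ : φ ∈ charts E M) (q : JetCoord E 0) (hq : q.1 ∈ φ.target) :
      ContDiffAt ℝ ∞ (fun q ↦ (gram fun i ↦ vfRep φ (K i)) (jetCoordZero E q)) q :=
    ContDiffAt.comp (g := gram fun i ↦ vfRep φ (K i)) q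
      (contDiffAt_gram_vfRep (p := jetCoordZero E q) hφ hKs hq)
      (jetCoordZero E).contDiff.contDiffAt
  refine ⟨isSmoothFun_of_coord (W := fun φ ↦ Prod.fst ⁻¹' φ.target)
    (fun φ _ ↦ φ.open_target.preimage continuous_fst) hC
    (fun φ _ η hη ↦ φ.map_source hη) hR, fun X θ ↦ ?_⟩
  set φ := chartAt E θ.1.pt
  have hφ : φ ∈ charts E M := chartAt_mem_charts θ.1.pt
  have hθ : θ.1.pt ∈ φ.source := mem_chart_source E θ.1.pt
  refine hasDerivAlong_of_coord (h𝔤 X.1 X.2 0 θ.1 θ.2) hφ hθ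
    ((hC φ hφ _ (φ.map_source hθ)).differentiableAt (by simp)) (hR φ hφ) ?_
  have hd := (contDiffAt_gram_vfRep (p := jetCoordZero E (θ.1.coord φ)) hφ hKs
    (φ.map_source hθ)).differentiableAt (by simp)
  rw [fderiv_comp_clm hd,
    jetCoordZero_prolong, jetCoordZero_coord,
    (hlam X).gram_prolong hφ hKs (φ.map_source hθ)]
  beta_reduce
  rw [RFun_eq_gram K _ hφ hθ]
  simp

theorem isRelativeInvariant_SFun {ℰ : JetPDE E M} {𝔤 : VFLieAlgebra E M}
    (h𝔤 : IsSymmetryAlgebra 𝔤 ℰ) {K : Fin r → VField E M}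
    (hK : ∀ i, K i ∈ 𝔤.toSubmodule) {lam : Module.Dual ℝ 𝔤.toSubmodule}
    (hlam : ∀ X : 𝔤.toSubmodule,
      IsLieDerivative X.1 (wedge K) (fun x ↦ lam X • wedge K x)) :
    IsRelativeInvariant 𝔤 ℰ 1 (fun θ ↦ SFun K θ.1) ((4 : ℝ) • lam) := by
  haveI : CompleteSpace E := FiniteDimensional.complete ℝ E
  have hKs i := 𝔤.smooth (K i) (hK i)
  let G (φ : OpenPartialHomeomorph M E)
    (q : E × (E →L[ℝ] E →L[ℝ] ℝ) × (E →L[ℝ] E →L[ℝ] E →L[ℝ] ℝ)) : ℝ :=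
    covNormSq q.2.1 (horDiff (gram fun i ↦ vfRep φ (K i)) q)
  have hS (φ) (hφ : φ ∈ charts E M) (η : ℰ.eqn 1) (hη : η.1.pt ∈ φ.source) :
      SFun K η.1 = G φ (jetCoordOne E (η.1.coord φ)) := by
    rw [jetCoordOne_coord, SFun_eq_covNormSq _ hφ hKs hη]
  have hG (φ) (hφ : φ ∈ charts E M)
      (q : E × (E →L[ℝ] E →L[ℝ] ℝ) × (E →L[ℝ] E →L[ℝ] E →L[ℝ] ℝ)) (hq : q.1 ∈ φ.target)
      (hq' : q.2.1.IsInvertible) : ContDiffAt ℝ ∞ (G φ) q :=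
    contDiffAt_covNormSq_horDiff (contDiffAt_gram_vfRep (p := (q.1, q.2.1)) hφ hKs hq) hq'
  -- The norm of a covector is smooth where the form is invertible. This is an open set of
  -- coordinates, and it contains those of all Lorentzian jets based in the chart domain.
  let W (φ : OpenPartialHomeomorph M E) : Set (JetCoord E 1) :=
    Prod.fst ⁻¹' φ.target ∩ {q | (jetCoordOne E q).2.1.IsInvertible}
  have hC (φ) (hφ : φ ∈ charts E M) (q : JetCoord E 1) (hq : q ∈ W φ) :
      ContDiffAt ℝ ∞ (fun q ↦ G φ (jetCoordOne E q)) q :=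
    ContDiffAt.comp (g := G φ) q (hG φ hφ (jetCoordOne E q) hq.1 hq.2)
      (jetCoordOne E).contDiff.contDiffAt
  have hW (φ : OpenPartialHomeomorph M E) : IsOpen (W φ) :=
    (φ.open_target.preimage continuous_fst).inter
      (ContinuousLinearEquiv.isOpen.preimage (by fun_prop :
        Continuous fun q : JetCoord E 1 ↦ (jetCoordOne E q).2.1))
  have hmem (φ) (hφ : φ ∈ charts E M) (η : ℰ.eqn 1) (hη : η.1.pt ∈ φ.source) :
      η.1.coord φ ∈ W φ :=
    ⟨φ.map_source hη, by
      rw [mem_ofPred_eq, jetCoordOne_coord]; exact η.1.isInvertible_formRep hφ hη⟩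
  refine ⟨isSmoothFun_of_coord (fun φ _ ↦ hW φ) hC hmem hS, fun X θ ↦ ?_⟩
  set φ := chartAt E θ.1.pt
  have hφ : φ ∈ charts E M := chartAt_mem_charts θ.1.pt
  have hθ : θ.1.pt ∈ φ.source := mem_chart_source E θ.1.pt
  have ht := φ.map_source hθ
  have hdom : φ.symm (φ θ.1.pt) ∈ θ.1.rep.dom := by rw [φ.left_inv hθ]; exact θ.1.pt_mem_dom
  refine hasDerivAlong_of_coord (h𝔤 X.1 X.2 1 θ.1 θ.2) hφ hθ
    ((hC φ hφ _ (hmem φ hφ θ hθ)).differentiableAt (by simp)) (hS φ hφ) ?_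
  have hd := (hG φ hφ (jetCoordOne E (θ.1.coord φ)) (hmem φ hφ θ hθ).1
    (hmem φ hφ θ hθ).2).differentiableAt (by simp)
  have hF := contDiffAt_gram_vfRep
    (p := (φ θ.1.pt, formRep φ θ.1.rep.toFun (φ θ.1.pt))) hφ hKs ht
  have hg := θ.1.rep.contDiffAt_formRep hφ ht hdom
  have hX := contDiffAt_vfRep hφ ht (𝔤.smooth X.1 X.2)
  -- The constant is the weight `2λ` of `R`; passing to the square norm doubles it. The identity for
  -- `R` is supplied on the whole chart target, since it has to be differentiated.
  have hhor := fderiv_horDiff_prolong (F := gram fun i ↦ vfRep φ (K i))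
    (L := lieForm (vfRep φ X.1) (formRep φ θ.1.rep.toFun)) (c := 2 * lam X) hF hg
    (differentiableAt_lieForm hX hg) (hX.differentiableAt (by simp))
    (by filter_upwards [φ.open_target.mem_nhds ht] with z hz
        exact (hlam X).gram_prolong hφ hKs hz _)
  rw [fderiv_comp_clm hd,
    jetCoordOne_prolong, jetCoordOne_coord]
  beta_reduce
  rw [SFun_eq_covNormSq _ hφ hKs hθ]
  refine (fderiv_covNormSq_horDiff (T := fderiv ℝ (vfRep φ X.1) (φ θ.1.pt)) hF
    (θ.1.isInvertible_formRep hφ hθ) (θ.1.formRep_symm hθ) (fun a b ↦ ?_) hhor).trans ?_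
  · simp [lieForm]
    ring
  · simp only [LinearMap.smul_apply, smul_eq_mul]
    ring

end Main

end JetInv

end

/-! ### The theorem: existence of the weight and the two relative invariants -/

theorem theorem1 {E : Type*} [NormedAddCommGroup E] [NormedSpace ℝ E] [FiniteDimensional ℝ E]
    {M : Type*} [TopologicalSpace M] [ChartedSpace E M] [IsManifold 𝓘(ℝ, E) ∞ M]
    (ℰ : JetInv.JetPDE E M) (𝔤 : JetInv.VFLieAlgebra E M)
    (h𝔤 : JetInv.IsSymmetryAlgebra 𝔤 ℰ)
    (𝔦 : Submodule ℝ (JetInv.VField E M)) (h𝔦 : JetInv.IsIdeal 𝔤 𝔦)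
    {r : ℕ} (hr : 1 ≤ r) (K : Fin r → JetInv.VField E M)
    (hK : LinearIndependent ℝ K) (hspan : Submodule.span ℝ (Set.range K) = 𝔦) :
    (∃ lam : Module.Dual ℝ 𝔤.toSubmodule, ∀ X : 𝔤.toSubmodule,
      JetInv.IsLieDerivative X.1 (JetInv.wedge K) (fun x ↦ lam X • JetInv.wedge K x)) ∧
    ∀ lam : Module.Dual ℝ 𝔤.toSubmodule,
      (∀ X : 𝔤.toSubmodule,
        JetInv.IsLieDerivative X.1 (JetInv.wedge K) (fun x ↦ lam X • JetInv.wedge K x)) →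
      JetInv.IsRelativeInvariant 𝔤 ℰ 0 (fun θ ↦ JetInv.RFun K θ.1) ((2 : ℝ) • lam) ∧
      JetInv.IsRelativeInvariant 𝔤 ℰ 1 (fun θ ↦ JetInv.SFun K θ.1) ((4 : ℝ) • lam) := by
  have hKi (i) : K i ∈ 𝔤.toSubmodule :=
    h𝔦.1 (hspan ▸ Submodule.subset_span (Set.mem_range_self i))
  exact ⟨JetInv.exists_weight h𝔦 hK hspan, fun lam hlam ↦
    ⟨JetInv.isRelativeInvariant_RFun h𝔤 hKi hlam, JetInv.isRelativeInvariant_SFun h𝔤 hKi hlam⟩⟩
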